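/- All graphs are finite and simple. A graph is chordal if it has no induced cycle of length four or more. A tree model of a graph $G=(V,E)$ is a pair $(T,\{T_u\}_{u\in V})$ where $T$ is a tree (the host tree), each $T_u$ is a non-empty subtree of $T$, and distinct vertices $u,v$ of $G$ are adjacent if and only if $V(T_u)\cap V(T_v)\neq\emptyset$. Let $\mathscr{L}(T)$ denote the set of leaves (vertices of degree one) of a tree $T$; a one-vertex tree has no leaves. The leafage $\ell(G)$ is the smallest integer $\ell$ such that $G$ has a tree model whose host tree has $\ell$ leaves, and the vertex leafage $v\ell(G)$ is the smallest integer $k$ such that $G$ has a tree model with $|\mathscr{L}(T_u)|\le k$ for all $u\in V$. For every chordal graph $G=(V,E)$ there exists a tree model $(T^*,\{T^*_u\}_{u\in V})$ of $G$ such that (i) $|\mathscr{L}(T^*_u)|\le v\ell(G)$ for all $u\in V$, and (ii) $|\mathscr{L}(T^*)|=\ell(G)$. That is, leafage and vertex leafage can be realized simultaneously. In particular, if $G$ is a path graph, i.e. $G$ has a path model (a tree model in which every subtree $T_u$ is a path, possibly a single vertex), then $G$ has a path model whose host tree has exactly $\ell(G)$ leaves. -/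

import Mathlib

namespace ChordalLeafage

/-- A graph is chordal if it has no induced cycle of length four or more. -/
def IsChordal {V : Type*} (G : SimpleGraph V) : Prop :=
  ∀ n : ℕ, 4 ≤ n → IsEmpty (SimpleGraph.cycleGraph n ↪g G)

/-- The leaves of a tree: its vertices of degree one. A one-vertex tree has no leaves. -/
def leaves {W : Type*} (T : SimpleGraph W) : Set W :=
  {x | (T.neighborSet x).ncard = 1}

/-- A tree model of `G`: a finite tree (the host tree) and, for every vertex of `G`, a
(nonempty) subtree of it, such that two distinct vertices of `G` are adjacent if and only if
their subtrees share a node. The nodes may be taken in `Type`, since every finite tree is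
isomorphic to one on such a type. -/
structure TreeModel {V : Type*} (G : SimpleGraph V) where
  /-- the nodes of the host tree -/
  Node : Type
  finite_node : Finite Node
  /-- the host tree -/
  host : SimpleGraph Node
  host_isTree : host.IsTree
  /-- the subtree that represents a vertex of `G` -/
  subtree : V → host.Subgraph
  subtree_isTree : ∀ u, (subtree u).coe.IsTree
  adj_iff : ∀ u v, u ≠ v →
    (G.Adj u v ↔ ((subtree u).verts ∩ (subtree v).verts).Nonempty)

/-- The number of leaves of the host tree. -/
noncomputable def TreeModel.hostLeaves {V : Type*} {G : SimpleGraph V} (M : TreeModel G) : ℕ :=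
  (leaves M.host).ncard

/-- The number of leaves of the subtree that represents the vertex `u`. -/
noncomputable def TreeModel.subtreeLeaves {V : Type*} {G : SimpleGraph V} (M : TreeModel G)
    (u : V) : ℕ :=
  (leaves (M.subtree u).coe).ncard

/-- A path model is a tree model in which every subtree is a path (possibly a single node). -/
def TreeModel.IsPathModel {V : Type*} {G : SimpleGraph V} (M : TreeModel G) : Prop :=
  ∀ u, ∃ (a b : M.Node) (p : M.host.Walk a b), p.IsPath ∧ M.subtree u = p.toSubgraph

/-- A path graph is the vertex intersection graph of a family of paths in a tree. -/
def IsPathGraph {V : Type*} (G : SimpleGraph V) : Prop :=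
  ∃ M : TreeModel G, M.IsPathModel

/-- The leafage of `G`: the least number of leaves of the host tree of a tree model of `G`. -/
noncomputable def leafage {V : Type*} (G : SimpleGraph V) : ℕ :=
  sInf {k | ∃ M : TreeModel G, M.hostLeaves = k}

/-- The vertex leafage of `G`: the least `k` for which there is a tree model of `G` all of whose
subtrees have at most `k` leaves. -/
noncomputable def vertexLeafage {V : Type*} (G : SimpleGraph V) : ℕ :=
  sInf {k | ∃ M : TreeModel G, ∀ u, M.subtreeLeaves u ≤ k}

end ChordalLeafage

/-! A tree model is the same as a tree whose nodes carry bags (the sets of vertices whose subtrees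
pass through the node), each vertex occupying a connected set of nodes. Given a model `M₁` with good
subtrees and a model `M₂` with a good host tree, a third model is built that is as good as `M₁` on
every subtree and as good as `M₂` on the host (`exists_bagTree_combining`).

Contracting an edge whose one bag lies inside the other increases no leaf count, so the bags may be
taken pairwise incomparable. By the Helly property they are then the maximal cliques of the graph,
so both trees live on the same nodes with the same bags.

Label an edge by the intersection of its end bags. For each label `S`, all trees with these bags
have equally many `S`-edges. If `T'` has more `S`-edges than `T` at a node `x`, then `T'` can be
changed so that `x` loses one `S`-edge and some node `y` with fewer `S`-edges than in `T` gains one,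
nothing else changing (`IsBagTree.exchange`). This is done only at nodes `x` of degree at least
three, where the loss at `x` pays for the gain at `y`, so the host gets no new leaves. The total
surplus over `T` drops each time. At the end every node of degree at least three has, for each
label, at most as many edges as in `T`. The degree of a node in the subtree of `u` is the sum of its
label counts over labels containing `u`, and nodes of degree at most two create no leaves beyond the
first two, so each subtree has no more leaves than in `T`.

The minima are attained once some model exists; for chordal graphs one is glued together along
clique separators. Path models are those whose subtrees all have at most two leaves. -/

namespace ChordalLeafage

/-! ### Connected sets in a forest and the Helly property. -/

open SimpleGraph

/-- The graph on all of `N` that keeps only the edges of `T` inside `A`. -/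
def restrict {N : Type*} (T : SimpleGraph N) (A : Set N) : SimpleGraph N where
  Adj x y := T.Adj x y ∧ x ∈ A ∧ y ∈ A
  symm := ⟨fun _ _ h => ⟨h.1.symm, h.2.2, h.2.1⟩⟩
  loopless := ⟨fun _ h => T.loopless.irrefl _ h.1⟩

/-- The set `A` is connected in `T`. -/
def ConnOn {N : Type*} (T : SimpleGraph N) (A : Set N) : Prop :=
  ∀ x ∈ A, ∀ y ∈ A, (restrict T A).Reachable x y

variable {N : Type*} {T : SimpleGraph N} {A B C : Set N}

theorem restrict_le : restrict T A ≤ T := fun _ _ h => h.1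

theorem restrict_univ : restrict T Set.univ = T := by
  ext x y
  simp [restrict]

theorem reachable_of_forall_adj {G H : SimpleGraph N} (h : ∀ a b, G.Adj a b → H.Reachable a b)
    {x y : N} (hxy : G.Reachable x y) : H.Reachable x y := by
  obtain ⟨p⟩ := hxy
  induction p with
  | nil => exact Reachable.refl _
  | cons hadj _ ih => exact (h _ _ hadj).trans ih

theorem mem_of_walk_restrict {x y : N} (p : (restrict T A).Walk x y) (hx : x ∈ A) :
    ∀ w ∈ p.support, w ∈ A := by
  induction p with
  | nil => simpa using hx
  | cons h p ih =>
    intro w hw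
    rw [Walk.support_cons, List.mem_cons] at hw
    rcases hw with rfl | hw
    · exact hx
    · exact ih h.2.2 w hw

theorem ConnOn.mem_of_isPath (hT : T.IsAcyclic) (hA : ConnOn T A) {x y : N} (hx : x ∈ A)
    (hy : y ∈ A) (p : T.Walk x y) (hp : p.IsPath) : ∀ w ∈ p.support, w ∈ A := by
  obtain ⟨q, hq⟩ := (hA x hx y hy).exists_isPath
  have := (hT.subsingleton_path x y).elim ⟨p, hp⟩
    ⟨q.mapLe restrict_le, hq.mapLe _⟩
  have h2 : p = q.mapLe restrict_le := congrArg Subtype.val this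
  intro w hw
  rw [h2, Walk.support_mapLe_eq_support] at hw
  exact mem_of_walk_restrict q hx w hw

theorem reachable_restrict_of_walk {x y : N} (p : T.Walk x y) (hp : ∀ w ∈ p.support, w ∈ A) :
    (restrict T A).Reachable x y := by
  induction p with
  | nil => exact Reachable.refl _
  | cons h p ih =>
    have h1 : (restrict T A).Adj _ _ :=
      ⟨h, hp _ (by simp), hp _ (by simp)⟩
    exact h1.reachable.trans (ih fun w hw => hp w (by simp [hw]))

theorem ConnOn.inter (hT : T.IsAcyclic) (hA : ConnOn T A) (hB : ConnOn T B) :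
    ConnOn T (A ∩ B) := by
  intro x hx y hy
  obtain ⟨p, hp⟩ := ((hA x hx.1 y hy.1).mono restrict_le).exists_isPath
  exact reachable_restrict_of_walk p fun w hw =>
    ⟨hA.mem_of_isPath hT hx.1 hy.1 p hp w hw, hB.mem_of_isPath hT hx.2 hy.2 p hp w hw⟩

/-- Read contrapositively with `isBridge_of_adj`: a connected set that meets both sides of a bridge
contains both of its ends. -/
theorem ConnOn.reachable_deleteEdges (hA : ConnOn T A) {x z a c : N} (h : ¬ (x ∈ A ∧ z ∈ A))
    (ha : a ∈ A) (hc : c ∈ A) : (T.deleteEdges {s(x, z)}).Reachable a c := by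
  refine (hA a ha c hc).mono fun u v huv => ?_
  rw [deleteEdges_adj]
  refine ⟨huv.1, fun he => h ?_⟩
  rw [Set.mem_singleton_iff, Sym2.eq_iff] at he
  rcases he with ⟨rfl, rfl⟩ | ⟨rfl, rfl⟩
  · exact huv.2
  · exact huv.2.symm

theorem isBridge_of_adj (hT : T.IsAcyclic) {x z : N} (h : T.Adj x z) :
    ¬ (T.deleteEdges {s(x, z)}).Reachable x z :=
  isBridge_iff.1 (isAcyclic_iff_forall_adj_isBridge.1 hT h)

/-- Follow the path from `q` in `C` towards `a` in `A`. If it left `C` before meeting `A`, then `C`,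
`A` and the rest of the path would together bypass the edge just crossed, which is a bridge. -/
theorem exists_mem_inter_of_path (hT : T.IsAcyclic) (hA : ConnOn T A) (hC : ConnOn T C)
    {q a r : N} (p : T.Walk q a) (hp : p.IsPath) (hB : ∀ w ∈ p.support, w ∈ B)
    (hq : q ∈ C) (ha : a ∈ A) (hrA : r ∈ A) (hrC : r ∈ C) : ∃ w ∈ B, w ∈ A ∧ w ∈ C := by
  induction p with
  | nil => exact ⟨_, hB _ (by simp), ha, hq⟩
  | @cons q q' a h p ih =>
    by_cases hqA : q ∈ A
    · exact ⟨q, hB _ (by simp), hqA, hq⟩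
    by_cases hqC : q' ∈ C
    · exact ih hp.of_cons (fun w hw => hB w (by simp [hw])) hqC ha
    exfalso
    have h1 := hA.reachable_deleteEdges (x := q) (z := q') (fun h => hqA h.1) hrA ha
    have h2 := hC.reachable_deleteEdges (x := q) (z := q') (fun h => hqC h.2) hq hrC
    have h3 : (T.deleteEdges {s(q, q')}).Reachable q' a := by
      refine ⟨p.toDeleteEdge _ fun he => ?_⟩
      exact (Walk.cons_isPath_iff _ _ |>.1 hp).2 (Walk.fst_mem_support_of_mem_edges _ he)
    exact isBridge_of_adj hT h (h2.trans (h1.trans h3.symm))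

/-- The Helly property for three connected sets in a forest. -/
theorem ConnOn.inter_inter_nonempty (hT : T.IsAcyclic) (hA : ConnOn T A) (hB : ConnOn T B)
    (hC : ConnOn T C) (hAB : (A ∩ B).Nonempty) (hBC : (B ∩ C).Nonempty)
    (hAC : (A ∩ C).Nonempty) : ∃ w ∈ B, w ∈ A ∧ w ∈ C := by
  obtain ⟨a, haA, haB⟩ := hAB
  obtain ⟨q, hqB, hqC⟩ := hBC
  obtain ⟨r, hrA, hrC⟩ := hAC
  obtain ⟨p, hp⟩ := ((hB q hqB a haB).mono restrict_le).exists_isPath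
  exact exists_mem_inter_of_path hT hA hC p hp (hB.mem_of_isPath hT hqB haB p hp) hqC haA hrA hrC

/-- The Helly property for finitely many connected sets in a forest. -/
theorem exists_mem_forall_of_pairwise (hT : T.IsAcyclic) [Nonempty N] {ι : Type*} (s : Finset ι) :
    ∀ A : ι → Set N, (∀ i ∈ s, ConnOn T (A i)) →
    (∀ i ∈ s, ∀ j ∈ s, (A i ∩ A j).Nonempty) → ∃ x, ∀ i ∈ s, x ∈ A i := by
  classical
  induction s using Finset.induction with
  | empty => exact fun _ _ _ => ⟨Classical.arbitrary N, by simp⟩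
  | insert a s ha ih =>
    intro A hconn hpair
    rcases s.eq_empty_or_nonempty with rfl | ⟨i₀, hi₀⟩
    · obtain ⟨x, hx, -⟩ := hpair a (by simp) a (by simp)
      exact ⟨x, by simpa using hx⟩
    obtain ⟨x, hx⟩ := ih (fun i => A i ∩ A a)
      (fun i hi => (hconn i (by simp [hi])).inter hT (hconn a (by simp)))
      (fun i hi j hj => by
        obtain ⟨w, h1, h2, h3⟩ := ConnOn.inter_inter_nonempty hT (hconn i (by simp [hi]))
          (hconn a (by simp)) (hconn j (by simp [hj])) (hpair i (by simp [hi]) a (by simp))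
          (hpair a (by simp) j (by simp [hj])) (hpair i (by simp [hi]) j (by simp [hj]))
        exact ⟨w, ⟨h2, h1⟩, h3, h1⟩)
    refine ⟨x, fun i hi => ?_⟩
    rw [Finset.mem_insert] at hi
    rcases hi with rfl | hi
    · exact (hx i₀ hi₀).2
    · exact (hx i hi).1

end ChordalLeafage

/-! ### Counting leaves through degrees. -/

namespace ChordalLeafage

open SimpleGraph

/-- The number of neighbours of `x` in the subforest of `T` spanned by `A`. -/
noncomputable def ndeg {N : Type*} (T : SimpleGraph N) (A : Set N) (x : N) : ℕ :=
  ((restrict T A).neighborSet x).ncard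

/-- For a subtree with at least two nodes this is its number of leaves minus two. -/
noncomputable def excess {N : Type*} [Fintype N] (T : SimpleGraph N) (A : Set N) : ℕ :=
  ∑ x, (ndeg T A x - 2)

variable {N : Type*} {T : SimpleGraph N} {A : Set N}

theorem ConnOn.preconnected_induce (hA : ConnOn T A) : (T.induce A).Preconnected := by
  have key : ∀ {x y : N} (p : (restrict T A).Walk x y) (hx : x ∈ A) (hy : y ∈ A),
      (T.induce A).Reachable ⟨x, hx⟩ ⟨y, hy⟩ := by
    intro x y p
    induction p with
    | nil => exact fun _ _ => Reachable.refl _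
    | cons h p ih =>
      intro hx hy
      have h1 : (T.induce A).Adj ⟨_, hx⟩ ⟨_, h.2.2⟩ := h.1
      exact h1.reachable.trans (ih h.2.2 hy)
  rintro ⟨x, hx⟩ ⟨y, hy⟩
  obtain ⟨p⟩ := hA x hx y hy
  exact key p hx hy

theorem connOn_of_preconnected_induce (h : (T.induce A).Preconnected) : ConnOn T A := by
  intro x hx y hy
  let f : T.induce A →g restrict T A := ⟨Subtype.val, fun {a b} hab => ⟨hab, a.2, b.2⟩⟩
  exact (h ⟨x, hx⟩ ⟨y, hy⟩).map f

theorem ConnOn.isTree_induce (hT : T.IsAcyclic) (hA : ConnOn T A) (hne : A.Nonempty) :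
    (T.induce A).IsTree :=
  ⟨(connected_iff _).2 ⟨hA.preconnected_induce, hne.to_subtype⟩, hT.induce A⟩

theorem ncard_neighborSet_induce (x : A) :
    ((T.induce A).neighborSet x).ncard = ndeg T A x := by
  rw [ndeg, ← Set.ncard_image_of_injective _ Subtype.val_injective]
  congr 1
  ext y
  constructor
  · rintro ⟨z, hz, rfl⟩
    exact ⟨hz, x.2, z.2⟩
  · rintro ⟨h1, h2, h3⟩
    exact ⟨⟨y, h3⟩, h1, rfl⟩

theorem ndeg_eq_zero_of_notMem {x : N} (hx : x ∉ A) : ndeg T A x = 0 := by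
  rw [ndeg]
  convert Set.ncard_empty N
  ext y
  simp [restrict, hx]

theorem ndeg_univ (x : N) : ndeg T Set.univ x = (T.neighborSet x).ncard := by
  rw [ndeg, restrict_univ]

theorem ncard_neighborSet_eq_degree [Fintype N] [DecidableRel T.Adj] (x : N) :
    (T.neighborSet x).ncard = T.degree x := by
  rw [← card_neighborSet_eq_degree, ← Nat.card_eq_fintype_card, Nat.card_coe_set_eq]

theorem sum_ncard_neighborSet [Fintype N] (hT : T.IsTree) :
    ∑ x, (T.neighborSet x).ncard + 2 = 2 * Fintype.card N := by
  classical
  simp_rw [ncard_neighborSet_eq_degree]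
  have := hT.card_edgeFinset
  have := T.sum_degrees_eq_twice_card_edges
  omega

theorem ncard_leaves [Fintype N] (hT : T.IsTree) (hN : Fintype.card N ≠ 1) :
    (leaves T).ncard = 2 + ∑ x, ((T.neighborSet x).ncard - 2) := by
  classical
  have hne : Nonempty N := hT.connected.nonempty
  have hN' : 1 < Fintype.card N := by
    have := Fintype.card_pos (α := N)
    omega
  have : Nontrivial N := Fintype.one_lt_card_iff_nontrivial.1 hN'
  have hsum := sum_ncard_neighborSet hT
  have hpos : ∀ x, 0 < (T.neighborSet x).ncard := fun x => by
    rw [ncard_neighborSet_eq_degree]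
    exact hT.connected.preconnected.degree_pos_of_nontrivial x
  have hl : (leaves T).ncard = ∑ x, if (T.neighborSet x).ncard = 1 then 1 else 0 := by
    rw [leaves, Set.ncard_eq_toFinset_card', ← Finset.card_filter]
    congr 1
    ext x
    simp
  -- Degrees are positive, so the truncated difference is wrong only at leaves, by one each; the
  -- degree sum is twice the number of nodes minus two.
  have h3 : ∑ x, ((T.neighborSet x).ncard - 2) + ∑ _x : N, 2 =
      ∑ x, (T.neighborSet x).ncard + ∑ x, if (T.neighborSet x).ncard = 1 then 1 else 0 := by
    rw [← Finset.sum_add_distrib, ← Finset.sum_add_distrib]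
    refine Finset.sum_congr rfl fun x _ => ?_
    have := hpos x
    split_ifs <;> omega
  rw [← hl] at h3
  simp only [Finset.sum_const, Finset.card_univ, smul_eq_mul] at h3
  omega

theorem leaves_eq_empty_of_subsingleton [Subsingleton N] : leaves T = ∅ := by
  ext x
  simp only [leaves, Set.mem_ofPred_eq, Set.mem_empty_iff_false, iff_false]
  simp

theorem sum_subtype_eq_sum [Fintype N] [Fintype A] {f : N → ℕ} (hf : ∀ x ∉ A, f x = 0) :
    ∑ x : A, f x = ∑ x, f x := by
  classical
  rw [Finset.sum_set_coe]
  refine Finset.sum_subset (Finset.subset_univ _) fun x _ hx => hf x ?_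
  simpa using hx

theorem ConnOn.sum_ndeg [Fintype N] (hT : T.IsAcyclic) (hA : ConnOn T A) (hne : A.Nonempty) :
    ∑ x, ndeg T A x + 2 = 2 * A.ncard := by
  classical
  have := sum_ncard_neighborSet (hA.isTree_induce hT hne)
  simp_rw [ncard_neighborSet_induce] at this
  rw [sum_subtype_eq_sum fun x hx => ndeg_eq_zero_of_notMem hx] at this
  rw [this, ← Nat.card_eq_fintype_card, Nat.card_coe_set_eq]

theorem ConnOn.ncard_leaves_induce [Fintype N] (hT : T.IsAcyclic) (hA : ConnOn T A)
    (hne : A.Nonempty) :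
    (leaves (T.induce A)).ncard = if A.ncard = 1 then 0 else 2 + excess T A := by
  classical
  have hc : Fintype.card A = A.ncard := by
    rw [← Nat.card_eq_fintype_card, Nat.card_coe_set_eq]
  split_ifs with h
  · have : Subsingleton A := Fintype.card_le_one_iff_subsingleton.1 (by omega)
    rw [leaves_eq_empty_of_subsingleton, Set.ncard_empty]
  · rw [ncard_leaves (hA.isTree_induce hT hne) (by omega), excess]
    simp_rw [ncard_neighborSet_induce]
    rw [sum_subtype_eq_sum (f := fun x => ndeg T A x - 2)
      fun x hx => by simp [ndeg_eq_zero_of_notMem hx]]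

theorem ncard_leaves_eq [Fintype N] (hT : T.IsTree) :
    (leaves T).ncard = if Fintype.card N = 1 then 0 else 2 + excess T Set.univ := by
  split_ifs with h
  · have : Subsingleton N := Fintype.card_le_one_iff_subsingleton.1 h.le
    rw [leaves_eq_empty_of_subsingleton, Set.ncard_empty]
  · rw [ncard_leaves hT h, excess]
    simp_rw [ndeg_univ]

/-- A tree is a minimal connected graph on its nodes, so a subtree of a forest has all edges that
the forest has between its nodes. -/
theorem coe_eq_induce (hT : T.IsAcyclic) (H : T.Subgraph) (hH : H.coe.IsTree) :
    H.coe = T.induce H.verts := by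
  have hle : H.coe ≤ T.induce H.verts := fun x y h => H.adj_sub h
  have h1 : (T.induce H.verts).IsTree := ⟨hH.connected.mono hle, hT.induce _⟩
  exact le_antisymm hle ((isTree_iff_minimal_connected.1 h1).2 hH.connected hle)

theorem connOn_verts (hT : T.IsAcyclic) (H : T.Subgraph) (hH : H.coe.IsTree) :
    ConnOn T H.verts := by
  apply connOn_of_preconnected_induce
  rw [← coe_eq_induce hT H hH]
  exact hH.connected.preconnected

theorem ncard_leaves_coe [Fintype N] (hT : T.IsAcyclic) (H : T.Subgraph) (hH : H.coe.IsTree) :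
    (leaves H.coe).ncard = if H.verts.ncard = 1 then 0 else 2 + excess T H.verts := by
  have := hH.connected.nonempty
  rw [coe_eq_induce hT H hH]
  exact (connOn_verts hT H hH).ncard_leaves_induce hT (Set.nonempty_coe_sort.1 this)

end ChordalLeafage

/-! ### Bag trees, edge labels and sliding an edge. -/

namespace ChordalLeafage

open SimpleGraph

/-- A tree whose nodes carry bags `b`, such that the nodes whose bags contain a given element
are connected. -/
structure IsBagTree {N V : Type*} (T : SimpleGraph N) (b : N → Set V) : Prop where
  isTree : T.IsTree
  connOn : ∀ u, ConnOn T {x | u ∈ b x}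

/-- The number of edges at `x` whose two ends have bags with intersection `S`. -/
noncomputable def labelDeg {N V : Type*} (T : SimpleGraph N) (b : N → Set V) (S : Set V)
    (x : N) : ℕ :=
  {z | T.Adj x z ∧ b x ∩ b z = S}.ncard

/-- The tree obtained from `T` by replacing the edge `xz` by the edge `yz`. -/
def slide {N : Type*} (T : SimpleGraph N) (x y z : N) : SimpleGraph N :=
  T.deleteEdges {s(x, z)} ⊔ edge y z

/-- The edges of `T` whose two ends have bags with intersection strictly larger than `S`. -/
def blockGraph {N V : Type*} (T : SimpleGraph N) (b : N → Set V) (S : Set V) :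
    SimpleGraph N where
  Adj x y := T.Adj x y ∧ S ⊂ b x ∩ b y
  symm := ⟨fun x y h => ⟨h.1.symm, by rw [Set.inter_comm]; exact h.2⟩⟩
  loopless := ⟨fun _ h => T.loopless.irrefl _ h.1⟩

variable {N V : Type*} {T T' : SimpleGraph N} {b : N → Set V} {S : Set V}

/-- The path between two such nodes stays in the subtree of every element of `S`. -/
theorem IsBagTree.connOn_superset (h : IsBagTree T b) (S : Set V) :
    ConnOn T {x | S ⊆ b x} := by
  intro x hx y hy
  obtain ⟨p, hp⟩ := (h.isTree.connected.preconnected x y).exists_isPath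
  exact reachable_restrict_of_walk p fun w hw u hu =>
    (h.connOn u).mem_of_isPath h.isTree.isAcyclic (hx hu) (hy hu) p hp w hw

theorem deleteEdges_sup_edge {x z : N} (h : T.Adj x z) :
    T.deleteEdges {s(x, z)} ⊔ edge x z = T := by
  ext a c
  simp only [sup_adj, deleteEdges_adj, edge_adj, Set.mem_singleton_iff, Sym2.eq_iff]
  constructor
  · rintro (h1 | ⟨⟨rfl, rfl⟩ | ⟨rfl, rfl⟩, -⟩)
    exacts [h1.1, h, h.symm]
  · intro h1
    have := h1.ne
    tauto

theorem labelDeg_sup_edge [Finite N] {H : SimpleGraph N} {y z : N} (hne : y ≠ z)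
    (hH : ¬ H.Adj y z) (S : Set V) (w : N) [Decidable (S = b y ∩ b z ∧ (w = y ∨ w = z))] :
    labelDeg (H ⊔ edge y z) b S w =
      labelDeg H b S w + if S = b y ∩ b z ∧ (w = y ∨ w = z) then 1 else 0 := by
  unfold labelDeg
  split_ifs with h
  · obtain ⟨rfl, rfl | rfl⟩ := h
    · rw [← Set.ncard_insert_of_notMem (a := z) (fun h => hH h.1)]
      congr 1
      ext c
      simp only [sup_adj, edge_adj, Set.mem_ofPred_eq, Set.mem_insert_iff]
      constructor
      · tauto
      · rintro (rfl | h)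
        · tauto
        · tauto
    · rw [← Set.ncard_insert_of_notMem (a := y) (fun h => hH h.1.symm)]
      congr 1
      ext c
      simp only [sup_adj, edge_adj, Set.mem_ofPred_eq, Set.mem_insert_iff]
      constructor
      · tauto
      · rintro (rfl | h)
        · exact ⟨Or.inr ⟨by simp, hne.symm⟩, Set.inter_comm _ _⟩
        · tauto
  · rw [add_zero]
    congr 1
    ext c
    simp only [sup_adj, edge_adj, Set.mem_ofPred_eq]
    constructor
    · rintro ⟨h1 | ⟨⟨rfl, rfl⟩ | ⟨rfl, rfl⟩, -⟩, h2⟩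
      · exact ⟨h1, h2⟩
      · exact absurd ⟨h2.symm, Or.inl rfl⟩ h
      · exact absurd ⟨by rw [← h2, Set.inter_comm], Or.inr rfl⟩ h
    · rintro ⟨h1, h2⟩
      exact ⟨Or.inl h1, h2⟩

section slide

variable {x y z : N}

/-- The new edge `yz` keeps the label of `xz`: the subtree of an element of both `b y` and `b z`
crosses the bridge `xz`, hence contains `x`. -/
theorem IsBagTree.inter_eq_of_reachable (h : IsBagTree T b) (hxz : T.Adj x z)
    (hy : (T.deleteEdges {s(x, z)}).Reachable x y) (hsub : b x ∩ b z ⊆ b y) :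
    b y ∩ b z = b x ∩ b z := by
  refine Set.Subset.antisymm (fun u hu => ?_) fun u hu => ⟨hsub hu, hu.2⟩
  by_contra hn
  exact isBridge_of_adj h.isTree.isAcyclic hxz
    (hy.trans ((h.connOn u).reachable_deleteEdges hn hu.1 hu.2))

/-- The lost edge `xz` is replaced by the path from `x` to `y` followed by `yz`; that path stays in
`A` because paths in a forest are unique. -/
theorem connOn_slide (hT : T.IsAcyclic) (hy : (T.deleteEdges {s(x, z)}).Reachable x y)
    {A : Set N} (hA : ConnOn T A) (hyA : x ∈ A → z ∈ A → y ∈ A) (hyz : y ≠ z) :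
    ConnOn (slide T x y z) A := by
  intro a ha c hc
  have edge_reach : x ∈ A → z ∈ A → (restrict (slide T x y z) A).Reachable x z := by
    intro hx hz
    obtain ⟨p, hp⟩ := hy.exists_isPath
    have hsupp := hA.mem_of_isPath hT hx (hyA hx hz) (p.mapLe (deleteEdges_le _)) (hp.mapLe _)
    rw [Walk.support_mapLe_eq_support] at hsupp
    have h1 := reachable_restrict_of_walk p hsupp
    have h2 : (restrict (slide T x y z) A).Adj y z :=
      ⟨Or.inr (by simp [edge_adj, hyz]), hyA hx hz, hz⟩
    refine (h1.mono fun u v huv => ?_).trans h2.reachable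
    exact ⟨Or.inl huv.1, huv.2⟩
  refine reachable_of_forall_adj (fun u v huv => ?_) (hA a ha c hc)
  by_cases he : s(u, v) = s(x, z)
  · rw [Sym2.eq_iff] at he
    rcases he with ⟨rfl, rfl⟩ | ⟨rfl, rfl⟩
    · exact edge_reach huv.2.1 huv.2.2
    · exact (edge_reach huv.2.2 huv.2.1).symm
  · refine Adj.reachable ⟨Or.inl ?_, huv.2⟩
    rw [deleteEdges_adj]
    exact ⟨huv.1, he⟩

theorem not_reachable_of_reachable (hT : T.IsAcyclic) (hxz : T.Adj x z)
    (hy : (T.deleteEdges {s(x, z)}).Reachable x y) :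
    ¬ (T.deleteEdges {s(x, z)}).Reachable y z :=
  fun h => isBridge_of_adj hT hxz (hy.trans h)

theorem IsBagTree.isBagTree_slide (h : IsBagTree T b) (hxz : T.Adj x z)
    (hy : (T.deleteEdges {s(x, z)}).Reachable x y) (hsub : b x ∩ b z ⊆ b y) :
    IsBagTree (slide T x y z) b := by
  have hT := h.isTree.isAcyclic
  have hnr := not_reachable_of_reachable hT hxz hy
  have hyz : y ≠ z := fun he => hnr (he ▸ Reachable.refl _)
  refine ⟨⟨(connected_iff _).2 ⟨?_, h.isTree.connected.nonempty⟩,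
    IsAcyclic.sup_edge_of_not_reachable hnr (hT.anti (deleteEdges_le _))⟩, fun u => ?_⟩
  · intro a c
    have h1 : ConnOn T Set.univ := fun a _ c _ => by
      rw [restrict_univ]
      exact h.isTree.connected.preconnected a c
    have h2 := connOn_slide hT hy h1 (fun _ _ => Set.mem_univ _) hyz a trivial c trivial
    exact h2.mono restrict_le
  · exact connOn_slide hT hy (h.connOn u) (fun hx hz => hsub ⟨hx, hz⟩) hyz

-- Both trees are `T` without `xz` plus one edge at `z` with the same label, so the count at `z`
-- cancels and only `x` and `y` are affected.
open Classical in
theorem IsBagTree.labelDeg_slide [Finite N] (h : IsBagTree T b) (hxz : T.Adj x z)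
    (hy : (T.deleteEdges {s(x, z)}).Reachable x y) (hsub : b x ∩ b z ⊆ b y) (S : Set V) (w : N) :
    labelDeg (slide T x y z) b S w +
        (if S = b x ∩ b z ∧ w = x then 1 else 0) =
      labelDeg T b S w + if S = b x ∩ b z ∧ w = y then 1 else 0 := by
  have hT := h.isTree.isAcyclic
  have hnr := not_reachable_of_reachable hT hxz hy
  have hyz : y ≠ z := fun he => hnr (he ▸ Reachable.refl _)
  have h1 := labelDeg_sup_edge (b := b) hyz (fun h => hnr h.reachable) S w
  have h2 := labelDeg_sup_edge (b := b) (H := T.deleteEdges {s(x, z)}) hxz.ne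
    (fun h => isBridge_of_adj hT hxz h.reachable) S w
  rw [deleteEdges_sup_edge hxz] at h2
  rw [slide, h1, h2, h.inter_eq_of_reachable hxz hy hsub]
  have := hxz.ne
  by_cases hS : S = b x ∩ b z
  · by_cases hwx : w = x
    · subst hwx
      by_cases hwy : w = y <;> simp [hS, hwy, this, hyz]
    · by_cases hwz : w = z
      · subst hwz
        simp [hS, hwx, hyz.symm]
      · simp [hS, hwx, hwz]
  · simp [hS]

end slide

/-! ### Label counts are determined by the bags. -/

open Classical in
theorem ndeg_superset [Finite N] [Fintype (Set V)] (S : Set V) (x : N) :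
    ndeg T {x | S ⊆ b x} x = ∑ S' : Set V with S ⊆ S', labelDeg T b S' x := by
  have := Fintype.ofFinite N
  have h1 : ndeg T {x | S ⊆ b x} x =
      (Finset.univ.filter fun z => T.Adj x z ∧ S ⊆ b x ∩ b z).card := by
    rw [ndeg, Set.ncard_eq_toFinset_card']
    congr 1
    ext z
    rw [Set.mem_toFinset, mem_neighborSet]
    simp [restrict]
  rw [h1, Finset.card_eq_sum_card_fiberwise (f := fun z => b x ∩ b z)
    (t := Finset.univ.filter fun S' => S ⊆ S')]
  · refine Finset.sum_congr rfl fun S' hS' => ?_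
    rw [labelDeg, Set.ncard_eq_toFinset_card']
    congr 1
    ext z
    have := (Finset.mem_filter.1 hS').2
    simp only [Finset.mem_filter, Finset.mem_univ, true_and, Set.mem_toFinset,
      Set.mem_ofPred_eq]
    constructor
    · tauto
    · rintro ⟨h1, rfl⟩
      exact ⟨⟨h1, this⟩, rfl⟩
  · intro z hz
    simpa using (Finset.mem_filter.1 hz).2.2

theorem IsBagTree.sum_ndeg_eq [Fintype N] (h : IsBagTree T b) (h' : IsBagTree T' b)
    (S : Set V) :
    ∑ x, ndeg T {x | S ⊆ b x} x = ∑ x, ndeg T' {x | S ⊆ b x} x := by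
  rcases Set.eq_empty_or_nonempty {x | S ⊆ b x} with he | hne
  · rw [he]
    simp [ndeg_eq_zero_of_notMem]
  · have h1 := (h.connOn_superset S).sum_ndeg h.isTree.isAcyclic hne
    have h2 := (h'.connOn_superset S).sum_ndeg h'.isTree.isAcyclic hne
    omega

/-- The number of edges with a given label depends only on the bags. -/
theorem IsBagTree.sum_labelDeg_eq [Finite V] [Fintype N] (h : IsBagTree T b)
    (h' : IsBagTree T' b) (S : Set V) :
    ∑ x, labelDeg T b S x = ∑ x, labelDeg T' b S x := by
  classical
  have := Fintype.ofFinite (Set V)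
  -- Downward induction: the edges with labels containing `S` span the subtree of nodes with bags
  -- containing `S`, so their number depends only on the bags; subtract those with strictly larger
  -- labels.
  induction S using WellFoundedGT.induction with
  | ind S ih =>
    have key := h.sum_ndeg_eq h' S
    simp_rw [ndeg_superset] at key
    rw [Finset.sum_comm, Finset.sum_comm (s := Finset.univ (α := N))] at key
    have hS : S ∈ Finset.univ.filter fun S' : Set V => S ⊆ S' := by simp
    rw [← Finset.add_sum_erase _ _ hS, ← Finset.add_sum_erase _ _ hS] at key
    have h2 : ∑ S' ∈ (Finset.univ.filter fun S' : Set V => S ⊆ S').erase S,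
        ∑ x, labelDeg T b S' x =
        ∑ S' ∈ (Finset.univ.filter fun S' : Set V => S ⊆ S').erase S,
        ∑ x, labelDeg T' b S' x := by
      refine Finset.sum_congr rfl fun S' hS' => ih S' ?_
      rw [Finset.mem_erase, Finset.mem_filter] at hS'
      exact lt_of_le_of_ne hS'.2.2 (Ne.symm hS'.1)
    omega

/-! ### Exchanging equally labelled edges between two bag trees. -/

theorem reachable_of_forall_adj_of_reachable {G H : SimpleGraph N} {z y : N}
    (h : ∀ a c, G.Adj a c → G.Reachable z a → H.Adj a c) (hzy : G.Reachable z y) :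
    H.Reachable z y := by
  obtain ⟨p⟩ := hzy
  induction p with
  | nil => exact Reachable.refl _
  | cons hadj _ ih =>
    exact (h _ _ hadj (Reachable.refl _)).reachable.trans
      (ih fun a c hac hr => h a c hac (hadj.reachable.trans hr))

theorem reachable_deleteEdges_or (hT : T.Connected) (x z y : N) :
    (T.deleteEdges {s(x, z)}).Reachable x y ∨ (T.deleteEdges {s(x, z)}).Reachable z y := by
  obtain ⟨p⟩ := hT.preconnected y x
  induction p with
  | nil => exact Or.inl (Reachable.refl _)
  | @cons u v w hadj p ih =>
    by_cases he : s(u, v) = s(w, z)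
    · rw [Sym2.eq_iff] at he
      rcases he with ⟨rfl, rfl⟩ | ⟨rfl, rfl⟩
      · exact Or.inl (Reachable.refl _)
      · exact Or.inr (Reachable.refl _)
    · have h1 : (T.deleteEdges {s(w, z)}).Adj v u := by
        rw [deleteEdges_adj, Sym2.eq_swap (a := v)]
        exact ⟨hadj.symm, he⟩
      exact ih.imp (·.trans h1.reachable) (·.trans h1.reachable)

/-- Walks inside a block thus survive the removal of any `S`-labelled edge. -/
theorem blockGraph_le_deleteEdges {p q : N} (hS : b p ∩ b q = S) :
    blockGraph T b S ≤ T.deleteEdges {s(p, q)} := by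
  intro u v huv
  rw [deleteEdges_adj]
  refine ⟨huv.1, fun he => ?_⟩
  rw [Set.mem_singleton_iff, Sym2.eq_iff] at he
  rcases he with ⟨rfl, rfl⟩ | ⟨rfl, rfl⟩
  · exact huv.2.ne hS.symm
  · exact huv.2.ne (by rw [← hS, Set.inter_comm])

theorem subset_of_reachable_blockGraph {p q : N} (h : (blockGraph T b S).Reachable p q)
    (hp : S ⊆ b p) : S ⊆ b q := by
  obtain ⟨w⟩ := h
  induction w with
  | nil => exact hp
  | cons h _ ih => exact ih (h.2.subset.trans Set.inter_subset_right)

theorem IsBagTree.reachable_blockGraph (h : IsBagTree T b) {p q : N} (hS : S ⊂ b p ∩ b q) :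
    (blockGraph T b S).Reachable p q := by
  have h1 := h.connOn_superset (b p ∩ b q) p Set.inter_subset_left q Set.inter_subset_right
  exact h1.mono fun u v (huv : (restrict T _).Adj u v) =>
    ⟨huv.1, hS.trans_subset (Set.subset_inter huv.2.1 huv.2.2)⟩

theorem exists_of_labelDeg_pos {x : N} (h : 0 < labelDeg T b S x) :
    ∃ z, T.Adj x z ∧ b x ∩ b z = S := by
  by_contra! hn
  rw [labelDeg, Set.eq_empty_of_forall_notMem (s := {z | T.Adj x z ∧ b x ∩ b z = S})
    fun z hz => hn z hz.1 hz.2] at h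
  simp at h

/-- If `x` is joined in `T'` to a node outside its block by an `S`-labelled edge, then some node
of the block of `x` has an `S`-labelled edge in `T`. -/
theorem IsBagTree.exists_mem_block [Finite N] (h : IsBagTree T b) (h' : IsBagTree T' b) {x z : N}
    (hS : b x ∩ b z = S) (hz : ¬ (blockGraph T' b S).Reachable x z) :
    ∃ p, (blockGraph T' b S).Reachable x p ∧ 0 < labelDeg T b S p := by
  obtain ⟨w⟩ := h.connOn_superset S x (hS ▸ Set.inter_subset_left) z
    (hS ▸ Set.inter_subset_right)
  obtain ⟨d, -, hd1, hd2⟩ := w.exists_boundary_dart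
    {p | (blockGraph T' b S).Reachable x p} (Reachable.refl _) hz
  refine ⟨d.fst, hd1, ?_⟩
  have hadj := d.adj
  rw [labelDeg, Set.ncard_pos]
  refine ⟨d.snd, hadj.1, ?_⟩
  by_contra hne
  have hss : S ⊂ b d.fst ∩ b d.snd :=
    lt_of_le_of_ne (Set.subset_inter hadj.2.1 hadj.2.2) (Ne.symm hne)
  exact hd2 (hd1.trans (h'.reachable_blockGraph hss))

-- If `y` lies on the side of `x` when an `S`-edge `xz` is removed, slide `xz` to `yz`. Otherwise a
-- second `S`-edge `pz'`, with `p` in the block of `x`, is slid to `yz'`, and then `xz` to `pz`; the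
-- node `p` loses and regains one edge.
open Classical in
theorem IsBagTree.exchange [Finite V] [Finite N] (h : IsBagTree T b) (h' : IsBagTree T' b)
    {x : N} (hx : labelDeg T b S x < labelDeg T' b S x) :
    ∃ (T'' : SimpleGraph N) (y : N), IsBagTree T'' b ∧ labelDeg T' b S y < labelDeg T b S y ∧
      ∀ S' w, labelDeg T'' b S' w + (if S' = S ∧ w = x then 1 else 0) =
        labelDeg T' b S' w + if S' = S ∧ w = y then 1 else 0 := by
  have := Fintype.ofFinite N
  have hT' := h'.isTree.isAcyclic
  obtain ⟨z, hxz, rfl⟩ := exists_of_labelDeg_pos (Nat.zero_lt_of_lt hx)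
  set S := b x ∩ b z with hS
  have hble : blockGraph T' b S ≤ T'.deleteEdges {s(x, z)} := blockGraph_le_deleteEdges rfl
  have hzblock : ¬ (blockGraph T' b S).Reachable x z :=
    fun hr => isBridge_of_adj hT' hxz (hr.mono hble)
  have direct : ∀ y, labelDeg T' b S y < labelDeg T b S y →
      (T'.deleteEdges {s(x, z)}).Reachable x y →
      ∃ (T'' : SimpleGraph N) (y : N), IsBagTree T'' b ∧ labelDeg T' b S y < labelDeg T b S y ∧
      ∀ S' w, labelDeg T'' b S' w + (if S' = S ∧ w = x then 1 else 0) =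
        labelDeg T' b S' w + if S' = S ∧ w = y then 1 else 0 := fun y hy hr => by
    obtain ⟨z', -, hz'⟩ := exists_of_labelDeg_pos (Nat.zero_lt_of_lt hy)
    have hsub : b x ∩ b z ⊆ b y := by
      rw [← hS, ← hz']
      exact Set.inter_subset_left
    exact ⟨slide T' x y z, y, h'.isBagTree_slide hxz hr hsub, hy, h'.labelDeg_slide hxz hr hsub⟩
  by_cases hblock : ∃ y, (blockGraph T' b S).Reachable x y ∧ labelDeg T' b S y < labelDeg T b S y
  · obtain ⟨y, hr, hy⟩ := hblock
    exact direct y hy (hr.mono hble)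
  push Not at hblock
  -- No node of the block of `x` is in deficit from here on, so an `S`-edge of `T` at a node `p` of
  -- the block forces one of `T'` at `p`.
  obtain ⟨p, hxp, hp⟩ := h.exists_mem_block h' hS.symm hzblock
  have hSp : S ⊆ b p := subset_of_reachable_blockGraph hxp Set.inter_subset_left
  -- When `p = x`, the strict surplus at `x` provides a second `S`-edge.
  obtain ⟨z', hpz', hlab, hne⟩ : ∃ z', T'.Adj p z' ∧ b p ∩ b z' = S ∧ ¬ (p = x ∧ z' = z) := by
    have hp' := hp.trans_le (hblock p hxp)
    by_cases hpx : p = x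
    · subst hpx
      have h2 : 1 < {z | T'.Adj p z ∧ b p ∩ b z = S}.ncard := by
        change 1 < labelDeg T' b S p
        omega
      obtain ⟨z', hz', hne⟩ := Set.exists_ne_of_one_lt_ncard h2 z
      exact ⟨z', hz'.1, hz'.2, fun h => hne h.2⟩
    · obtain ⟨z', h1, h2⟩ := exists_of_labelDeg_pos hp'
      exact ⟨z', h1, h2, fun h => hpx h.1⟩
  have hedge : s(x, z) ≠ s(p, z') := by
    intro he
    rw [Sym2.eq_iff] at he
    rcases he with ⟨rfl, rfl⟩ | ⟨rfl, rfl⟩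
    · exact hne ⟨rfl, rfl⟩
    · exact hzblock hxp
  -- The totals agree, so the surplus at `x` is matched by a deficit somewhere.
  obtain ⟨y, hy⟩ : ∃ y, labelDeg T' b S y < labelDeg T b S y := by
    by_contra! hn
    exact (Finset.sum_lt_sum (fun i _ => hn i) ⟨x, Finset.mem_univ _, hx⟩).ne
      (h.sum_labelDeg_eq h' S)
  rcases reachable_deleteEdges_or h'.isTree.connected x z y with hr | hr
  · exact direct y hy hr
  have hSy : S ⊆ b y := by
    obtain ⟨w, -, hw⟩ := exists_of_labelDeg_pos (Nat.zero_lt_of_lt hy)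
    rw [← hw]
    exact Set.inter_subset_left
  have hble' : blockGraph T' b S ≤ T'.deleteEdges {s(p, z')} := blockGraph_le_deleteEdges hlab
  -- Go from `p` to `x` in the block, over `xz`, and on to `y` on the side of `z`; that side does
  -- not contain `p`, so `pz'` is never used.
  have hpy : (T'.deleteEdges {s(p, z')}).Reachable p y := by
    have h1 : (T'.deleteEdges {s(p, z')}).Adj x z := by
      rw [deleteEdges_adj]
      exact ⟨hxz, hedge⟩
    refine (hxp.symm.mono hble').trans (h1.reachable.trans ?_)
    refine reachable_of_forall_adj_of_reachable (fun a c hac hza => ?_) hr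
    rw [deleteEdges_adj]
    refine ⟨(deleteEdges_le _) hac, fun he => ?_⟩
    rw [Set.mem_singleton_iff, Sym2.eq_iff] at he
    have hnp : ¬ (T'.deleteEdges {s(x, z)}).Reachable z p := fun hzp =>
      isBridge_of_adj hT' hxz ((hxp.mono hble).trans hzp.symm)
    rcases he with ⟨rfl, rfl⟩ | ⟨rfl, rfl⟩
    · exact hnp hza
    · exact hnp (hza.trans hac.reachable)
  have hsub1 : b p ∩ b z' ⊆ b y := hlab ▸ hSy
  have h1 := h'.isBagTree_slide hpz' hpy hsub1
  have hd1 := h'.labelDeg_slide hpz' hpy hsub1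
  have hadj1 : (slide T' p y z').Adj x z := by
    refine Or.inl ?_
    rw [deleteEdges_adj]
    exact ⟨hxz, hedge⟩
  have hr1 : ((slide T' p y z').deleteEdges {s(x, z)}).Reachable x p := by
    refine hxp.mono fun u v huv => ?_
    have h2 := hble huv
    rw [deleteEdges_adj] at h2 ⊢
    exact ⟨Or.inl (hble' huv), h2.2⟩
  refine ⟨slide (slide T' p y z') x p z, y, h1.isBagTree_slide hadj1 hr1 hSp, hy, fun S' w => ?_⟩
  have e1 := hd1 S' w
  have e2 := h1.labelDeg_slide hadj1 hr1 hSp S' w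
  rw [hlab] at e1
  rw [← hS] at e2
  omega

/-! ### Removing the surplus at nodes of degree at least three. -/

theorem ndeg_mono [Finite N] {A B : Set N} (hAB : A ⊆ B) (x : N) :
    ndeg T A x ≤ ndeg T B x :=
  Set.ncard_le_ncard fun _ h => ⟨h.1, hAB h.2.1, hAB h.2.2⟩

open Classical in
theorem ndeg_univ_eq_sum [Finite N] [Fintype (Set V)] (x : N) :
    ndeg T Set.univ x = ∑ S' : Set V, labelDeg T b S' x := by
  have := ndeg_superset (T := T) (b := b) ∅ x
  simpa using this

/-- Among the bag trees with a given bag function there is one with at most as many leaves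
as `T'` that has at nodes of degree at least three no more edges of any label than `T`. -/
theorem IsBagTree.exists_labelDeg_le [Finite V] [Fintype N] (h : IsBagTree T b)
    (h' : IsBagTree T' b) :
    ∃ T'' : SimpleGraph N, IsBagTree T'' b ∧ excess T'' Set.univ ≤ excess T' Set.univ ∧
      ∀ S x, 3 ≤ ndeg T'' Set.univ x → labelDeg T'' b S x ≤ labelDeg T b S x := by
  classical
  have := Fintype.ofFinite (Set V)
  -- Induction on the total surplus of `T'` over `T`.
  induction hn : ∑ S : Set V, ∑ x, (labelDeg T' b S x - labelDeg T b S x)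
    using Nat.strong_induction_on generalizing T' with
  | _ n ih =>
    by_cases hgood : ∀ S x, 3 ≤ ndeg T' Set.univ x → labelDeg T' b S x ≤ labelDeg T b S x
    · exact ⟨T', h', le_rfl, hgood⟩
    push Not at hgood
    obtain ⟨S, x, hdeg, hx⟩ := hgood
    obtain ⟨T₁, y, h₁, hy, hd⟩ := h.exchange h' hx
    have hlt : ∑ S : Set V, ∑ x, (labelDeg T₁ b S x - labelDeg T b S x) < n := by
      rw [← hn]
      have hle : ∀ S' w, labelDeg T₁ b S' w - labelDeg T b S' w ≤
          labelDeg T' b S' w - labelDeg T b S' w := by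
        intro S' w
        have := hd S' w
        -- The node `y` was in deficit, so gaining one edge creates no surplus there.
        by_cases h2 : S' = S ∧ w = y
        · obtain ⟨rfl, rfl⟩ := h2
          split_ifs at this <;> omega
        · rw [if_neg h2] at this
          omega
      refine Finset.sum_lt_sum (fun S' _ => Finset.sum_le_sum fun w _ => hle S' w)
        ⟨S, Finset.mem_univ _, Finset.sum_lt_sum (fun w _ => hle S w) ⟨x, Finset.mem_univ _, ?_⟩⟩
      have h3 := hd S x
      have hxy : x ≠ y := by
        rintro rfl
        omega
      simp only [and_self, if_true, true_and, hxy, if_false] at h3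
      omega
    have hex : excess T₁ Set.univ ≤ excess T' Set.univ := by
      have hnd : ∀ w, ndeg T₁ Set.univ w + (if w = x then 1 else 0) =
          ndeg T' Set.univ w + if w = y then 1 else 0 := by
        intro w
        have h2 := Finset.sum_congr (s₁ := Finset.univ) rfl fun S' _ => hd S' w
        rw [Finset.sum_add_distrib, Finset.sum_add_distrib, ← ndeg_univ_eq_sum,
          ← ndeg_univ_eq_sum] at h2
        simpa [ite_and, Finset.sum_ite_eq'] using h2
      -- Since `x` has degree at least three, its truncated term really drops by one, which pays for
      -- the increase of at most one at `y`.
      have h3 : ∑ w, (ndeg T₁ Set.univ w - 2) + ∑ w, (if w = x then 1 else 0) ≤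
          ∑ w, (ndeg T' Set.univ w - 2) + ∑ w, if w = y then 1 else 0 := by
        rw [← Finset.sum_add_distrib, ← Finset.sum_add_distrib]
        refine Finset.sum_le_sum fun w _ => ?_
        have h4 := hnd w
        by_cases hwx : w = x
        · subst hwx
          split_ifs at h4 ⊢ <;> omega
        · split_ifs at h4 ⊢ <;> omega
      simp only [Finset.sum_ite_eq', Finset.mem_univ, if_true] at h3
      exact Nat.le_of_add_le_add_right h3
    obtain ⟨T₂, h21, h22, h23⟩ := ih _ hlt h₁ rfl
    exact ⟨T₂, h21, h22.trans hex, h23⟩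

theorem IsBagTree.exists_excess_le [Finite V] [Fintype N] (h : IsBagTree T b)
    (h' : IsBagTree T' b) :
    ∃ T'' : SimpleGraph N, IsBagTree T'' b ∧ excess T'' Set.univ ≤ excess T' Set.univ ∧
      ∀ u, excess T'' {x | u ∈ b x} ≤ excess T {x | u ∈ b x} := by
  classical
  have := Fintype.ofFinite (Set V)
  obtain ⟨T'', h1, h2, h3⟩ := h.exists_labelDeg_le h'
  refine ⟨T'', h1, h2, fun u => Finset.sum_le_sum fun x _ => ?_⟩
  have h4 := ndeg_mono (T := T'') (Set.subset_univ {x | u ∈ b x}) x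
  -- A node of degree at most two contributes zero to the excess of every subtree.
  by_cases hdeg : 3 ≤ ndeg T'' Set.univ x
  · have hu : {x | u ∈ b x} = {x | {u} ⊆ b x} := by simp
    rw [hu, ndeg_superset, ndeg_superset]
    exact Nat.sub_le_sub_right (Finset.sum_le_sum fun S _ => h3 S x hdeg) 2
  · omega

end ChordalLeafage

/-! ### Contracting edges until the bags are incomparable. -/

namespace ChordalLeafage

open SimpleGraph

/-- The image of a graph under a map of its vertices, without loops. -/
def collapse {N N' : Type*} (T : SimpleGraph N) (c : N → N') : SimpleGraph N' where
  Adj p q := p ≠ q ∧ ∃ p' q', T.Adj p' q' ∧ c p' = p ∧ c q' = q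
  symm := ⟨fun _ _ ⟨h, p', q', h1, h2, h3⟩ => ⟨h.symm, q', p', h1.symm, h3, h2⟩⟩
  loopless := ⟨fun _ h => h.1 rfl⟩

open Classical in
/-- The map that moves `x` to `y` and fixes all other nodes. -/
noncomputable def contractMap {N : Type*} {x y : N} (hyx : y ≠ x) (w : N) : {w // w ≠ x} :=
  if h : w = x then ⟨y, hyx⟩ else ⟨w, h⟩

variable {N N' V : Type*} {T T' : SimpleGraph N} {b : N → Set V} {S : Set V}

theorem reachable_collapse {G : SimpleGraph N} {H : SimpleGraph N'} {c : N → N'}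
    (h : ∀ p q, G.Adj p q → c p ≠ c q → H.Adj (c p) (c q)) {p q : N} (hpq : G.Reachable p q) :
    H.Reachable (c p) (c q) := by
  obtain ⟨w⟩ := hpq
  induction w with
  | nil => exact Reachable.refl _
  | @cons u v _ hadj _ ih =>
    by_cases huv : c u = c v
    · rw [huv]
      exact ih
    · exact (h _ _ hadj huv).reachable.trans ih

theorem ConnOn.collapse {A : Set N} (hA : ConnOn T A) (c : N → N') :
    ConnOn (collapse T c) (c '' A) := by
  rintro _ ⟨p, hp, rfl⟩ _ ⟨q, hq, rfl⟩
  exact reachable_collapse (G := restrict T A)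
    (H := restrict (ChordalLeafage.collapse T c) (c '' A))
    (fun u v huv hne => ⟨⟨hne, u, v, huv.1, rfl, rfl⟩,
      ⟨u, huv.2.1, rfl⟩, ⟨v, huv.2.2, rfl⟩⟩) (hA p hp q hq)

section contract

variable {x y : N} (hyx : y ≠ x)

@[simp]
theorem contractMap_self : contractMap hyx x = ⟨y, hyx⟩ := dif_pos rfl

theorem contractMap_of_ne {w : N} (h : w ≠ x) : contractMap hyx w = ⟨w, h⟩ := dif_neg h

theorem eq_of_contractMap_eq {w : N} {p : {w // w ≠ x}} (h : contractMap hyx w = p) :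
    w = p ∨ w = x ∧ p.1 = y := by
  by_cases hw : w = x
  · subst hw
    rw [contractMap_self] at h
    exact Or.inr ⟨rfl, congrArg Subtype.val h.symm⟩
  · rw [contractMap_of_ne hyx hw] at h
    exact Or.inl (congrArg Subtype.val h)

theorem contractMap_image {A : Set N} (hA : x ∈ A → y ∈ A) :
    contractMap hyx '' A = {w | w.1 ∈ A} := by
  ext w
  constructor
  · rintro ⟨v, hv, hvw⟩
    rcases eq_of_contractMap_eq hyx hvw with rfl | ⟨rfl, h⟩
    · exact hv
    · have := hA hv
      rwa [← h] at this
  · intro hw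
    exact ⟨w.1, hw, contractMap_of_ne hyx w.2⟩

/-- The contracted graph is connected with one node fewer, and the edge `xy` is lost, so its edge
count is that of a tree. -/
theorem isTree_collapse [Finite N] (hT : T.IsTree) (hxy : T.Adj x y) :
    (collapse T (contractMap hyx)).IsTree := by
  have hconn : (collapse T (contractMap hyx)).Connected := by
    refine (connected_iff _).2 ⟨fun p q => ?_, ⟨⟨y, hyx⟩⟩⟩
    have := reachable_collapse (H := collapse T (contractMap hyx)) (c := contractMap hyx)
      (fun u v huv hne => ⟨hne, u, v, huv, rfl, rfl⟩) (hT.connected.preconnected p.1 q.1)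
    rwa [contractMap_of_ne hyx p.2, contractMap_of_ne hyx q.2] at this
  refine isTree_iff_connected_and_card.2 ⟨hconn, ?_⟩
  have h1 := hconn.card_vert_le_card_edgeSet_add_one
  have h2 := (isTree_iff_connected_and_card.1 hT).2
  have h3 : Nat.card {w // w ≠ x} + 1 = Nat.card N := by
    have h4 : Nat.card {w // w ≠ x} = ({x}ᶜ : Set N).ncard := by
      rw [← Nat.card_coe_set_eq]
      rfl
    have h5 := Set.ncard_add_ncard_compl ({x} : Set N)
    rw [Set.ncard_singleton] at h5
    omega
  have h6 : (collapse T (contractMap hyx)).edgeSet ⊆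
      Sym2.map (contractMap hyx) '' (T.edgeSet \ {s(x, y)}) := by
    intro e
    induction e using Sym2.ind with
    | _ p q =>
      rintro ⟨hne, p', q', hadj, rfl, rfl⟩
      refine ⟨s(p', q'), ⟨hadj, fun he => hne ?_⟩, rfl⟩
      rw [Set.mem_singleton_iff, Sym2.eq_iff] at he
      rcases he with ⟨rfl, rfl⟩ | ⟨rfl, rfl⟩
      · rw [contractMap_self, contractMap_of_ne hyx hyx]
      · rw [contractMap_self, contractMap_of_ne hyx hyx]
  have h7 := (Set.ncard_le_ncard h6).trans (Set.ncard_image_le (Set.toFinite _))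
  have h8 := Set.ncard_sdiff_singleton_add_one (s := T.edgeSet) (a := s(x, y)) hxy
  have h9 := Nat.card_coe_set_eq T.edgeSet
  have h10 := Nat.card_coe_set_eq (collapse T (contractMap hyx)).edgeSet
  omega

theorem IsBagTree.collapse [Finite N] (h : IsBagTree T b) (hxy : T.Adj x y) (hb : b x ⊆ b y) :
    IsBagTree (collapse T (contractMap hyx)) fun w => b w.1 := by
  refine ⟨isTree_collapse hyx h.isTree hxy, fun u => ?_⟩
  have := (h.connOn u).collapse (contractMap hyx)
  rwa [contractMap_image hyx fun hx => hb hx] at this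

theorem ConnOn.mem_of_adj_of_adj (hT : T.IsAcyclic) {A : Set N} (hA : ConnOn T A) {w : N}
    (hwx : T.Adj w x) (hxy : T.Adj x y) (hne : w ≠ y) (hw : w ∈ A) (hy : y ∈ A) : x ∈ A := by
  by_contra hx
  refine isBridge_of_adj hT hwx ((hA.reachable_deleteEdges (fun h => hx h.2) hw hy).trans ?_)
  refine Adj.reachable ?_
  rw [deleteEdges_adj]
  refine ⟨hxy.symm, fun he => ?_⟩
  rw [Set.mem_singleton_iff, Sym2.eq_iff] at he
  rcases he with ⟨rfl, -⟩ | ⟨-, rfl⟩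
  · exact hne rfl
  · exact hwx.ne rfl

theorem ndeg_collapse_le [Finite N] (hT : T.IsAcyclic) (hxy : T.Adj x y) {A : Set N}
    (hA : ConnOn T A) (w : {w // w ≠ x}) (hw : w.1 ≠ y) :
    ndeg (collapse T (contractMap hyx)) {w | w.1 ∈ A} w ≤ ndeg T A w := by
  refine le_trans (Set.ncard_le_ncard ?_) (Set.ncard_image_le (f := contractMap hyx)
    (Set.toFinite _))
  rintro q ⟨⟨hne, p', q', hadj, hp', hq'⟩, hwA, hqA⟩
  refine ⟨q', ?_, hq'⟩
  have hpw : p' = w := by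
    rcases eq_of_contractMap_eq hyx hp' with h | ⟨-, h⟩
    · exact h
    · exact absurd h hw
  subst hpw
  refine ⟨hadj, hwA, ?_⟩
  rcases eq_of_contractMap_eq hyx hq' with h | ⟨h, h'⟩
  · rw [h]
    exact hqA
  · subst h
    exact hA.mem_of_adj_of_adj hT hadj hxy hw hwA (h' ▸ hqA)

/-- If `x` is in `A`, the merged node inherits the edges of both ends except `xy`, counted once at
each end; otherwise it inherits at most those of `y`. -/
theorem ndeg_collapse_self_le [Finite N] (hT : T.IsAcyclic) (hxy : T.Adj x y) {A : Set N}
    (hA : ConnOn T A) (hxA : x ∈ A → y ∈ A) :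
    ndeg (collapse T (contractMap hyx)) {w | w.1 ∈ A} ⟨y, hyx⟩ - 2 ≤
      (ndeg T A x - 2) + (ndeg T A y - 2) := by
  have hsub : Subtype.val '' ((restrict (ChordalLeafage.collapse T (contractMap hyx))
      {w | w.1 ∈ A}).neighborSet ⟨y, hyx⟩) ⊆
      ((restrict T A).neighborSet y \ {x}) ∪ ((restrict T A).neighborSet x \ {y}) := by
    rintro _ ⟨q, ⟨⟨hne, p', q', hadj, hp', hq'⟩, hyA, hqA⟩, rfl⟩
    have hqy : q.1 ≠ y := fun h => hne (Subtype.ext h.symm)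
    have hqq : q' = q.1 := by
      rcases eq_of_contractMap_eq hyx hq' with h | ⟨-, h⟩
      · exact h
      · exact absurd h hqy
    subst hqq
    rcases eq_of_contractMap_eq hyx hp' with h | ⟨h, -⟩
    · subst h
      exact Or.inl ⟨⟨hadj, hyA, hqA⟩, q.2⟩
    · subst h
      exact Or.inr ⟨⟨hadj, hA.mem_of_adj_of_adj hT hadj.symm hxy hqy hqA hyA, hqA⟩, hqy⟩
  have h1 := (Set.ncard_le_ncard hsub).trans (Set.ncard_union_le _ _)
  rw [Set.ncard_image_of_injective _ Subtype.val_injective] at h1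
  change ndeg _ _ _ ≤ _ at h1
  by_cases hx : x ∈ A
  · have h2 := Set.ncard_sdiff_singleton_add_one (s := (restrict T A).neighborSet y) (a := x)
      ⟨hxy.symm, hxA hx, hx⟩
    have h3 := Set.ncard_sdiff_singleton_add_one (s := (restrict T A).neighborSet x) (a := y)
      ⟨hxy, hx, hxA hx⟩
    change _ = ndeg T A y at h2
    change _ = ndeg T A x at h3
    omega
  · have h2 := Set.ncard_sdiff_singleton_le ((restrict T A).neighborSet y) x
    have h3 := Set.ncard_sdiff_singleton_le ((restrict T A).neighborSet x) y
    have h4 := ndeg_eq_zero_of_notMem (T := T) hx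
    change _ ≤ ndeg T A y at h2
    change _ ≤ ndeg T A x at h3
    omega

theorem excess_collapse_le [Fintype N] [Fintype {w // w ≠ x}] (hT : T.IsAcyclic)
    (hxy : T.Adj x y) {A : Set N} (hA : ConnOn T A) (hxA : x ∈ A → y ∈ A) :
    excess (collapse T (contractMap hyx)) {w | w.1 ∈ A} ≤ excess T A := by
  classical
  have h1 : excess T A = (ndeg T A x - 2) + ∑ w : {w // w ≠ x}, (ndeg T A w.1 - 2) := by
    rw [excess, Fintype.sum_eq_add_sum_subtype_ne _ x]
    congr!
  rw [h1, excess, ← Finset.add_sum_erase _ _ (Finset.mem_univ (⟨y, hyx⟩ : {w // w ≠ x})),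
    ← Finset.add_sum_erase _ (fun w : {w // w ≠ x} => ndeg T A w.1 - 2)
      (Finset.mem_univ (⟨y, hyx⟩ : {w // w ≠ x})), ← add_assoc]
  refine add_le_add (ndeg_collapse_self_le hyx hT hxy hA hxA) (Finset.sum_le_sum fun w hw => ?_)
  refine Nat.sub_le_sub_right (ndeg_collapse_le hyx hT hxy hA w fun h => ?_) 2
  exact (Finset.mem_erase.1 hw).1 (Subtype.ext h)

end contract

theorem IsBagTree.exists_adj_subset (h : IsBagTree T b) {p q : N} (hpq : p ≠ q)
    (hb : b p ⊆ b q) : ∃ r, T.Adj p r ∧ b p ⊆ b r := by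
  obtain ⟨w⟩ := h.connOn_superset (b p) p (Set.Subset.refl (b p)) q hb
  cases w with
  | nil => exact absurd rfl hpq
  | cons hadj _ => exact ⟨_, hadj.1, hadj.2.2⟩

theorem connOn_univ (hT : T.IsTree) : ConnOn T Set.univ := fun a _ c _ => by
  rw [restrict_univ]
  exact hT.connected.preconnected a c

/-- Contracting edges, every bag tree becomes one whose bags are pairwise incomparable. -/
theorem IsBagTree.exists_antichain {N : Type} [Fintype N] {T : SimpleGraph N} {b : N → Set V}
    (h : IsBagTree T b) :
    ∃ (N' : Type) (_ : Fintype N') (T' : SimpleGraph N') (b' : N' → Set V), IsBagTree T' b' ∧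
      (∀ p q, b' p ⊆ b' q → p = q) ∧
      (∀ u v, (∃ p, u ∈ b' p ∧ v ∈ b' p) ↔ ∃ p, u ∈ b p ∧ v ∈ b p) ∧
      Fintype.card N' ≤ Fintype.card N ∧ excess T' Set.univ ≤ excess T Set.univ ∧
      ∀ u, {p | u ∈ b' p}.ncard ≤ {p | u ∈ b p}.ncard ∧
        excess T' {p | u ∈ b' p} ≤ excess T {p | u ∈ b p} := by
  classical
  induction hn : Fintype.card N using Nat.strong_induction_on generalizing N with
  | _ n ih =>
    by_cases hanti : ∀ p q, b p ⊆ b q → p = q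
    · exact ⟨N, inferInstance, T, b, h, hanti, fun _ _ => Iff.rfl, hn.le, le_rfl,
        fun _ => ⟨le_rfl, le_rfl⟩⟩
    push Not at hanti
    obtain ⟨x, q, hb, hne⟩ := hanti
    obtain ⟨y, hxy, hb⟩ := h.exists_adj_subset hne hb
    have hyx := hxy.ne'
    have hT := h.isTree.isAcyclic
    have hcard : Fintype.card {w // w ≠ x} < n := by
      rw [← hn]
      exact Fintype.card_subtype_lt (x := x) (by simp)
    obtain ⟨N', i, T', b', h1, h2, h3, h4, h5, h6⟩ := ih _ hcard (h.collapse hyx hxy hb) rfl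
    refine ⟨N', i, T', b', h1, h2, fun u v => (h3 u v).trans ⟨?_, ?_⟩, h4.trans hcard.le,
      h5.trans ?_, fun u => ⟨(h6 u).1.trans ?_, (h6 u).2.trans ?_⟩⟩
    · rintro ⟨p, hp⟩
      exact ⟨p.1, hp⟩
    · rintro ⟨p, hu, hv⟩
      by_cases hp : p = x
      · subst hp
        exact ⟨⟨y, hyx⟩, hb hu, hb hv⟩
      · exact ⟨⟨p, hp⟩, hu, hv⟩
    · have := excess_collapse_le hyx hT hxy (connOn_univ h.isTree) (fun _ => trivial)
      simpa using this
    · rw [← Set.ncard_image_of_injective _ Subtype.val_injective]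
      refine Set.ncard_le_ncard ?_
      rintro _ ⟨p, hp, rfl⟩
      exact hp
    · have hu : x ∈ {p | u ∈ b p} → y ∈ {p | u ∈ b p} := fun hx => hb hx
      have := excess_collapse_le hyx hT hxy (h.connOn u) hu
      exact this

/-! ### Identifying the nodes of two models. -/

/-- A set of pairwise jointly represented elements is contained in a bag. -/
theorem IsBagTree.exists_superset [Finite V] (h : IsBagTree T b) {s : Set V}
    (hs : ∀ u ∈ s, ∀ v ∈ s, ∃ p, u ∈ b p ∧ v ∈ b p) : ∃ p, s ⊆ b p := by
  have := h.isTree.connected.nonempty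
  obtain ⟨p, hp⟩ := exists_mem_forall_of_pairwise h.isTree.isAcyclic s.toFinite.toFinset
    (fun u => {p | u ∈ b p}) (fun u _ => h.connOn u)
    (fun u hu v hv => hs u (by simpa using hu) v (by simpa using hv))
  exact ⟨p, fun u hu => hp u (by simpa using hu)⟩

/-- By the Helly property each bag of one tree lies in a bag of the other; going back and forth
gives a comparable bag, hence the same node. -/
theorem exists_equiv_of_antichain [Finite V] {T' : SimpleGraph N'} {b' : N' → Set V}
    (h : IsBagTree T b) (h' : IsBagTree T' b') (ha : ∀ p q, b p ⊆ b q → p = q)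
    (ha' : ∀ p q, b' p ⊆ b' q → p = q)
    (heq : ∀ u v, (∃ p, u ∈ b p ∧ v ∈ b p) ↔ ∃ p, u ∈ b' p ∧ v ∈ b' p) :
    ∃ e : N ≃ N', ∀ p, b' (e p) = b p := by
  have h1 : ∀ p, ∃ q, b p ⊆ b' q := fun p =>
    h'.exists_superset fun u hu v hv => (heq u v).1 ⟨p, hu, hv⟩
  have h2 : ∀ p, ∃ q, b' p ⊆ b q := fun p =>
    h.exists_superset fun u hu v hv => (heq u v).2 ⟨p, hu, hv⟩
  choose f hf using h1
  choose g hg using h2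
  have hgf : ∀ p, g (f p) = p := fun p => (ha _ _ ((hf p).trans (hg _))).symm
  have hfg : ∀ p, f (g p) = p := fun p => (ha' _ _ ((hg p).trans (hf _))).symm
  refine ⟨⟨f, g, hgf, hfg⟩, fun p => Set.Subset.antisymm ?_ (hf p)⟩
  have := hg (f p)
  rwa [hgf] at this

theorem IsBagTree.comap {T' : SimpleGraph N'} {b' : N' → Set V} (h : IsBagTree T' b')
    (e : N ≃ N') : IsBagTree (T'.comap e) fun p => b' (e p) := by
  refine ⟨(Iso.comap e T').isTree_iff.2 h.isTree, fun u x hx y hy => ?_⟩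
  let f : restrict T' {p | u ∈ b' p} →g restrict (T'.comap e) {p | u ∈ b' (e p)} :=
    ⟨e.symm, fun {a c} hac => by simpa [restrict] using hac⟩
  have := (h.connOn u (e x) hx (e y) hy).map f
  simpa [f] using this

theorem excess_comap [Fintype N] [Fintype N'] (T' : SimpleGraph N') (e : N ≃ N') :
    excess (T'.comap e) Set.univ = excess T' Set.univ := by
  rw [excess, excess, ← Equiv.sum_comp e]
  refine Finset.sum_congr rfl fun x _ => ?_
  congr 1
  rw [ndeg_univ, ndeg_univ, ← Set.ncard_image_of_injective _ e.injective]
  congr 1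
  ext y
  constructor
  · rintro ⟨z, hz, rfl⟩
    exact hz
  · intro hy
    exact ⟨e.symm y, by simpa using hy, by simp⟩

/-- Two bag trees that represent the same graph can be combined into one that is as good as the
first on every subtree and as good as the second on the host tree. -/
theorem exists_bagTree_combining [Finite V] {N₁ N₂ : Type} [Fintype N₁] [Fintype N₂]
    {T₁ : SimpleGraph N₁} {T₂ : SimpleGraph N₂} {b₁ : N₁ → Set V} {b₂ : N₂ → Set V}
    (h₁ : IsBagTree T₁ b₁) (h₂ : IsBagTree T₂ b₂)
    (heq : ∀ u v, (∃ p, u ∈ b₁ p ∧ v ∈ b₁ p) ↔ ∃ p, u ∈ b₂ p ∧ v ∈ b₂ p) :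
    ∃ (N : Type) (_ : Fintype N) (T : SimpleGraph N) (b : N → Set V), IsBagTree T b ∧
      (∀ u v, (∃ p, u ∈ b p ∧ v ∈ b p) ↔ ∃ p, u ∈ b₁ p ∧ v ∈ b₁ p) ∧
      Fintype.card N ≤ Fintype.card N₂ ∧ excess T Set.univ ≤ excess T₂ Set.univ ∧
      ∀ u, {p | u ∈ b p}.ncard ≤ {p | u ∈ b₁ p}.ncard ∧
        excess T {p | u ∈ b p} ≤ excess T₁ {p | u ∈ b₁ p} := by
  obtain ⟨N, i, T, b, h, ha, he, -, -, hu⟩ := h₁.exists_antichain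
  obtain ⟨N', i', T', b', h', ha', he', hc', hx', -⟩ := h₂.exists_antichain
  obtain ⟨e, hb⟩ := exists_equiv_of_antichain h h' ha ha'
    fun u v => (he u v).trans ((heq u v).trans (he' u v).symm)
  -- Moves the second tree to the nodes of the first, so that both have the same bag function.
  have h'' := h'.comap e
  simp_rw [hb] at h''
  obtain ⟨T'', ht, hx'', hu''⟩ := h.exists_excess_le h''
  refine ⟨N, i, T'', b, ht, he, (Fintype.card_congr e).trans_le hc', ?_, fun u =>
    ⟨(hu u).1, (hu'' u).trans (hu u).2⟩⟩
  rw [excess_comap] at hx''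
  exact hx''.trans hx'

end ChordalLeafage

/-! ### Chordal graphs have tree models. -/

namespace ChordalLeafage

open SimpleGraph

variable {V : Type*} {G : SimpleGraph V}

theorem cycleGraph_adj_iff {n : ℕ} (hn : 2 ≤ n) (i j : Fin n) :
    (cycleGraph n).Adj i j ↔ (i.val = j.val + 1 ∨ j.val = i.val + 1) ∨
      (i.val = 0 ∧ j.val + 1 = n) ∨ (j.val = 0 ∧ i.val + 1 = n) := by
  have hi := i.2
  have hj := j.2
  have key : ∀ a c : Fin n, (a - c).val = 1 ↔
      a.val = c.val + 1 ∨ (a.val = 0 ∧ c.val + 1 = n) := by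
    intro a c
    have ha := a.2
    have hc := c.2
    rcases le_or_gt c a with h | h
    · have h1 := Fin.coe_sub_iff_le.2 h
      have h2 : c.val ≤ a.val := h
      omega
    · have h1 := Fin.coe_sub_iff_lt.2 h
      have h2 : a.val < c.val := h
      omega
  rw [cycleGraph_adj', key, key]
  tauto

/-- In a chordal graph, two nonadjacent neighbours of `v` are not joined through vertices that
are not adjacent to `v`. -/
theorem IsChordal.adj_of_reachable (hG : IsChordal G) {s t v : V} {C : Set V} (hst : s ≠ t)
    (hvs : G.Adj v s) (hvt : G.Adj v t) (hvC : v ∉ C) (hC : ∀ c ∈ C, ¬ G.Adj v c)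
    (hr : (restrict G (C ∪ {s, t})).Reachable s t) : G.Adj s t := by
  by_contra hadj
  set A : Set V := C ∪ {s, t} with hA
  set H := restrict G A with hH
  have hsA : s ∈ A := by simp [hA]
  have htA : t ∈ A := by simp [hA]
  have hvA : v ∉ A := by
    rintro (h | rfl | rfl)
    · exact hvC h
    · exact hvs.ne rfl
    · exact hvt.ne rfl
  obtain ⟨p, hp⟩ := hr.exists_walk_length_eq_dist
  have hm : 1 < H.dist s t := hr.one_lt_dist_of_ne_of_not_adj hst fun h => hadj h.1
  set m := H.dist s t with hmdef
  have hpA : ∀ i, p.getVert i ∈ A := fun i =>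
    mem_of_walk_restrict p hsA _ (p.getVert_mem_support i)
  have hd : ∀ i ≤ m, H.dist s (p.getVert i) = i := by
    intro i hi
    have h1 : H.dist s (p.getVert i) ≤ i := by
      refine (dist_le (p.take i)).trans ?_
      rw [Walk.take_length]
      exact min_le_left _ _
    have h2 : H.dist (p.getVert i) t ≤ m - i := by
      refine (dist_le (p.drop i)).trans ?_
      rw [Walk.drop_length, hp]
    have h3 : H.Reachable s (p.getVert i) := ⟨p.take i⟩
    have h4 := h3.dist_triangle_left t
    omega
  have hvp : ∀ i ≤ m, G.Adj v (p.getVert i) ↔ i = 0 ∨ i = m := by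
    intro i hi
    constructor
    · intro h
      rcases hpA i with h1 | h1 | h1
      · exact absurd h (hC _ h1)
      · have := hd i hi
        rw [h1, dist_self] at this
        exact Or.inl this.symm
      · have := hd i hi
        rw [Set.mem_singleton_iff.1 h1] at this
        exact Or.inr this.symm
    · rintro (rfl | rfl)
      · simpa using hvs
      · rw [← hp, Walk.getVert_length]
        exact hvt
  have hpp : ∀ i ≤ m, ∀ j ≤ m, G.Adj (p.getVert i) (p.getVert j) ↔ i = j + 1 ∨ j = i + 1 := by
    intro i hi j hj
    constructor
    · intro h
      have h1 : H.Adj (p.getVert i) (p.getVert j) := ⟨h, hpA i, hpA j⟩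
      have h2 : H.Reachable s (p.getVert i) := ⟨p.take i⟩
      have h3 : H.Reachable s (p.getVert j) := ⟨p.take j⟩
      have h4 := h2.dist_triangle_left (p.getVert j)
      have h5 := h3.dist_triangle_left (p.getVert i)
      rw [hd i hi, hd j hj, dist_eq_one_iff_adj.2 h1] at h4
      rw [hd i hi, hd j hj, dist_eq_one_iff_adj.2 h1.symm] at h5
      have h6 : i ≠ j := by
        rintro rfl
        exact h.ne rfl
      omega
    · rintro (rfl | rfl)
      · exact (p.adj_getVert_succ (by omega)).1.symm
      · exact (p.adj_getVert_succ (by omega)).1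
  -- A shortest path from `s` to `t` has `m + 1` vertices, with `m ≥ 2`; closing it up through `v`
  -- gives an induced cycle of length `m + 2 ≥ 4`.
  let f : Fin (m + 2) → V := fun i => if i.val ≤ m then p.getVert i.val else v
  have hf : Function.Injective f := by
    intro i j hij
    have hi := i.2
    have hj := j.2
    apply Fin.ext
    simp only [f] at hij
    split_ifs at hij with h1 h2 h2
    · rw [← hd _ h1, hij, hd _ h2]
    · exact absurd (hij ▸ hpA i) hvA
    · exact absurd (hij ▸ hpA j) hvA
    · omega
  refine (hG (m + 2) (by omega)).false ⟨⟨f, hf⟩, fun {i j} => ?_⟩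
  rw [cycleGraph_adj_iff (by omega)]
  have hi := i.2
  have hj := j.2
  simp only [Function.Embedding.coeFn_mk, f]
  split_ifs with h1 h2 h2
  · rw [hpp _ h1 _ h2]
    omega
  · rw [G.adj_comm, hvp _ h1]
    omega
  · rw [hvp _ h2]
    omega
  · simp only [SimpleGraph.irrefl, false_iff]
    omega

/-- A tree with bags that represents the subgraph of `G` induced by `W`. -/
structure Represents {N V : Type*} (G : SimpleGraph V) (W : Set V) (T : SimpleGraph N)
    (b : N → Set V) : Prop extends IsBagTree T b where
  cover : ∀ u, (∃ p, u ∈ b p) ↔ u ∈ W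
  adj_iff : ∀ u ∈ W, ∀ v ∈ W, u ≠ v → (G.Adj u v ↔ ∃ p, u ∈ b p ∧ v ∈ b p)

section glue

variable {N₁ N₂ : Type*} {T₁ : SimpleGraph N₁} {T₂ : SimpleGraph N₂}

theorem isTree_sum_sup_edge [Finite N₁] [Finite N₂] (h₁ : T₁.IsTree) (h₂ : T₂.IsTree)
    (x₁ : N₁) (x₂ : N₂) : ((T₁ ⊕g T₂) ⊔ edge (Sum.inl x₁) (Sum.inr x₂)).IsTree := by
  have hc : ((T₁ ⊕g T₂) ⊔ edge (Sum.inl x₁) (Sum.inr x₂)).Connected :=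
    h₁.connected.sum_sup_edge h₂.connected
  refine isTree_iff_connected_and_card.2 ⟨hc, ?_⟩
  have e1 := (isTree_iff_connected_and_card.1 h₁).2
  have e2 := (isTree_iff_connected_and_card.1 h₂).2
  have e3 := hc.card_vert_le_card_edgeSet_add_one
  have e4 : Nat.card (T₁ ⊕g T₂).edgeSet = Nat.card T₁.edgeSet + Nat.card T₂.edgeSet := by
    rw [Nat.card_congr (edgeSetSumEquiv (G := T₁) (H := T₂)), Nat.card_sum]
  have e5 : ((T₁ ⊕g T₂) ⊔ edge (Sum.inl x₁) (Sum.inr x₂)).edgeSet ⊆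
      insert s(Sum.inl x₁, Sum.inr x₂) (T₁ ⊕g T₂).edgeSet := by
    rw [edgeSet_sup]
    rintro e (he | he)
    · exact Or.inr he
    · rw [edge, edgeSet_fromEdgeSet] at he
      exact Or.inl he.1
  have e6 := (Set.ncard_le_ncard e5 (Set.toFinite _)).trans (Set.ncard_insert_le _ _)
  have e7 := Nat.card_coe_set_eq (T₁ ⊕g T₂).edgeSet
  have e8 := Nat.card_coe_set_eq ((T₁ ⊕g T₂) ⊔ edge (Sum.inl x₁) (Sum.inr x₂)).edgeSet
  have e9 : Nat.card (N₁ ⊕ N₂) = Nat.card N₁ + Nat.card N₂ := Nat.card_sum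
  omega

theorem IsBagTree.glue [Finite N₁] [Finite N₂] {b₁ : N₁ → Set V} {b₂ : N₂ → Set V}
    (h₁ : IsBagTree T₁ b₁) (h₂ : IsBagTree T₂ b₂) (x₁ : N₁) (x₂ : N₂)
    (hx : ∀ u, (∃ p, u ∈ b₁ p) → (∃ p, u ∈ b₂ p) → u ∈ b₁ x₁ ∧ u ∈ b₂ x₂) :
    IsBagTree ((T₁ ⊕g T₂) ⊔ edge (Sum.inl x₁) (Sum.inr x₂)) (Sum.elim b₁ b₂) := by
  refine ⟨isTree_sum_sup_edge h₁.isTree h₂.isTree x₁ x₂, fun u => ?_⟩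
  set A : Set (N₁ ⊕ N₂) := {p | u ∈ Sum.elim b₁ b₂ p}
  set T := (T₁ ⊕g T₂) ⊔ edge (Sum.inl x₁) (Sum.inr x₂)
  let f₁ : restrict T₁ {p | u ∈ b₁ p} →g restrict T A :=
    ⟨Sum.inl, fun {a c} h => ⟨Or.inl h.1, h.2.1, h.2.2⟩⟩
  let f₂ : restrict T₂ {p | u ∈ b₂ p} →g restrict T A :=
    ⟨Sum.inr, fun {a c} h => ⟨Or.inl h.1, h.2.1, h.2.2⟩⟩
  have hl : ∀ p q, u ∈ b₁ p → u ∈ b₁ q → (restrict T A).Reachable (Sum.inl p) (Sum.inl q) :=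
    fun p q hp hq => (h₁.connOn u p hp q hq).map f₁
  have hr : ∀ p q, u ∈ b₂ p → u ∈ b₂ q → (restrict T A).Reachable (.inr p) (.inr q) :=
    fun p q hp hq => (h₂.connOn u p hp q hq).map f₂
  have hlr : ∀ p q, u ∈ b₁ p → u ∈ b₂ q → (restrict T A).Reachable (.inl p) (.inr q) := by
    intro p q hp hq
    obtain ⟨h1, h2⟩ := hx u ⟨p, hp⟩ ⟨q, hq⟩
    have h3 : (restrict T A).Adj (.inl x₁) (.inr x₂) :=
      ⟨Or.inr (by simp [edge_adj]), h1, h2⟩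
    exact (hl p x₁ hp h1).trans (h3.reachable.trans (hr x₂ q h2 hq))
  rintro (p | p) hp (q | q) hq
  · exact hl p q hp hq
  · exact hlr p q hp hq
  · exact (hlr q p hq hp).symm
  · exact hr p q hp hq

/-- The common part is a clique, so by the Helly property each tree has a bag containing it; an edge
joins these two nodes. By `hsep`, no edge of `G` is missed. -/
theorem Represents.glue [Finite N₁] [Finite N₂] [Finite V] {b₁ : N₁ → Set V} {b₂ : N₂ → Set V}
    {W₁ W₂ : Set V} (h₁ : Represents G W₁ T₁ b₁) (h₂ : Represents G W₂ T₂ b₂)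
    (hclique : ∀ u ∈ W₁ ∩ W₂, ∀ v ∈ W₁ ∩ W₂, u ≠ v → G.Adj u v)
    (hsep : ∀ u ∈ W₁, ∀ v ∈ W₂, G.Adj u v → v ∈ W₁ ∨ u ∈ W₂) :
    ∃ T : SimpleGraph (N₁ ⊕ N₂), Represents G (W₁ ∪ W₂) T (Sum.elim b₁ b₂) := by
  have hs₁ : ∀ u ∈ W₁ ∩ W₂, ∀ v ∈ W₁ ∩ W₂, ∃ p, u ∈ b₁ p ∧ v ∈ b₁ p := by
    intro u hu v hv
    by_cases huv : u = v
    · subst huv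
      obtain ⟨p, hp⟩ := (h₁.cover u).2 hu.1
      exact ⟨p, hp, hp⟩
    · exact (h₁.adj_iff u hu.1 v hv.1 huv).1 (hclique u hu v hv huv)
  have hs₂ : ∀ u ∈ W₁ ∩ W₂, ∀ v ∈ W₁ ∩ W₂, ∃ p, u ∈ b₂ p ∧ v ∈ b₂ p := by
    intro u hu v hv
    by_cases huv : u = v
    · subst huv
      obtain ⟨p, hp⟩ := (h₂.cover u).2 hu.2
      exact ⟨p, hp, hp⟩
    · exact (h₂.adj_iff u hu.2 v hv.2 huv).1 (hclique u hu v hv huv)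
  obtain ⟨x₁, hx₁⟩ := h₁.exists_superset hs₁
  obtain ⟨x₂, hx₂⟩ := h₂.exists_superset hs₂
  have hbag := h₁.toIsBagTree.glue h₂.toIsBagTree x₁ x₂ fun u hu₁ hu₂ => by
    have hu : u ∈ W₁ ∩ W₂ := ⟨(h₁.cover u).1 hu₁, (h₂.cover u).1 hu₂⟩
    exact ⟨hx₁ hu, hx₂ hu⟩
  refine ⟨_, hbag, fun u => ?_, fun u hu v hv huv => ?_⟩
  · rw [Sum.exists, Set.mem_union, ← h₁.cover, ← h₂.cover]
    rfl
  · rw [Sum.exists]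
    simp only [Sum.elim_inl, Sum.elim_inr]
    constructor
    · intro hadj
      have key : u ∈ W₁ ∧ v ∈ W₁ ∨ u ∈ W₂ ∧ v ∈ W₂ := by
        rcases hu with hu | hu <;> rcases hv with hv | hv
        · exact Or.inl ⟨hu, hv⟩
        · rcases hsep u hu v hv hadj with h | h
          · exact Or.inl ⟨hu, h⟩
          · exact Or.inr ⟨h, hv⟩
        · rcases hsep v hv u hu hadj.symm with h | h
          · exact Or.inl ⟨h, hv⟩
          · exact Or.inr ⟨hu, h⟩
        · exact Or.inr ⟨hu, hv⟩
      rcases key with ⟨h5, h6⟩ | ⟨h5, h6⟩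
      · exact Or.inl ((h₁.adj_iff u h5 v h6 huv).1 hadj)
      · exact Or.inr ((h₂.adj_iff u h5 v h6 huv).1 hadj)
    · rintro (⟨p, h5, h6⟩ | ⟨p, h5, h6⟩)
      · exact (h₁.adj_iff u ((h₁.cover u).1 ⟨p, h5⟩) v ((h₁.cover v).1 ⟨p, h6⟩) huv).2 ⟨p, h5, h6⟩
      · exact (h₂.adj_iff u ((h₂.cover u).1 ⟨p, h5⟩) v ((h₂.cover v).1 ⟨p, h6⟩) huv).2 ⟨p, h5, h6⟩

end glue

theorem represents_of_clique {W : Set V} (hW : ∀ u ∈ W, ∀ v ∈ W, u ≠ v → G.Adj u v) :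
    Represents G W (⊥ : SimpleGraph Unit) fun _ => W where
  isTree := IsTree.of_subsingleton
  connOn _ _ _ _ _ := Reachable.refl _
  cover u := by simp
  adj_iff u hu v hv huv := by simp [hu, hv, hW u hu v hv huv]

/-- Let `C` be the component of `w` among the vertices of `W` other than `v` and its neighbours, and
`S` the neighbours of `v` in `W` attached to `C`. Two vertices of `S` are joined through `C`, so
chordality makes them adjacent. The parts are `C ∪ S`, which misses `v`, and `W \ C`, which misses
`w`. -/
theorem exists_clique_separation [Finite V] (hG : IsChordal G) {W : Set V} {v w : V} (hv : v ∈ W)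
    (hw : w ∈ W) (hvw : v ≠ w) (hadj : ¬ G.Adj v w) :
    ∃ W₁ W₂ : Set V, W₁ ⊂ W ∧ W₂ ⊂ W ∧ W₁ ∪ W₂ = W ∧
      (∀ a ∈ W₁ ∩ W₂, ∀ c ∈ W₁ ∩ W₂, a ≠ c → G.Adj a c) ∧
      ∀ a ∈ W₁, ∀ c ∈ W₂, G.Adj a c → c ∈ W₁ ∨ a ∈ W₂ := by
  set D : Set V := {a | a ∈ W ∧ a ≠ v ∧ ¬ G.Adj v a} with hD
  set C : Set V := {c | c ∈ D ∧ (restrict G D).Reachable w c} with hC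
  set S : Set V := {s | s ∈ W ∧ G.Adj v s ∧ ∃ c ∈ C, G.Adj s c} with hS
  have hwC : w ∈ C := ⟨⟨hw, hvw.symm, hadj⟩, Reachable.refl _⟩
  have hCW : C ⊆ W := fun c hc => hc.1.1
  have hSC : ∀ s ∈ S, s ∉ C := fun s hs hc => hc.1.2.2 hs.2.1
  have hvC : v ∉ C := fun h => h.1.2.1 rfl
  have hconn : ∀ c ∈ C, (restrict G C).Reachable w c := by
    intro c hc
    refine reachable_of_forall_adj_of_reachable (fun a d had hwa => ?_) hc.2
    exact ⟨had.1, ⟨had.2.1, hwa⟩, ⟨had.2.2, hwa.trans had.reachable⟩⟩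
  refine ⟨C ∪ S, W \ C, ?_, ?_, ?_, ?_, ?_⟩
  · refine ⟨Set.union_subset hCW fun s hs => hs.1, fun h => ?_⟩
    rcases h hv with h | h
    · exact hvC h
    · exact h.2.1.ne rfl
  · exact ⟨Set.sdiff_subset, fun h => (h hw).2 hwC⟩
  · ext a
    simp only [Set.mem_union, Set.mem_sdiff]
    constructor
    · rintro ((h | h) | h)
      exacts [hCW h, h.1, h.1]
    · intro h
      by_cases hc : a ∈ C
      · exact Or.inl (Or.inl hc)
      · exact Or.inr ⟨h, hc⟩
  · rintro s ⟨hs | hs, -, hs'⟩ t ⟨ht | ht, -, ht'⟩ hst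
    · exact absurd hs hs'
    · exact absurd hs hs'
    · exact absurd ht ht'
    obtain ⟨c, hc, hsc⟩ := hs.2.2
    obtain ⟨d, hd, htd⟩ := ht.2.2
    refine hG.adj_of_reachable hst hs.2.1 ht.2.1 hvC (fun c hc => hc.1.2.2) ?_
    have h1 : (restrict G (C ∪ {s, t})).Adj s c := ⟨hsc, by simp, Or.inl hc⟩
    have h2 : (restrict G (C ∪ {s, t})).Adj d t := ⟨htd.symm, Or.inl hd, by simp⟩
    refine h1.reachable.trans (Reachable.trans ?_ h2.reachable)
    exact ((hconn c hc).symm.trans (hconn d hd)).mono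
      fun a e (hae : (restrict G C).Adj a e) => ⟨hae.1, Or.inl hae.2.1, Or.inl hae.2.2⟩
  · rintro a (ha | ha) c ⟨hcW, hcC⟩ hac
    · left
      right
      refine ⟨hcW, ?_, a, ha, hac.symm⟩
      by_contra hvc
      refine hcC ⟨⟨hcW, ?_, hvc⟩, ?_⟩
      · rintro rfl
        exact ha.1.2.2 hac.symm
      · have h1 : (restrict G D).Adj a c := by
          refine ⟨hac, ha.1, hcW, ?_, hvc⟩
          rintro rfl
          exact ha.1.2.2 hac.symm
        exact ha.2.trans h1.reachable
    · exact Or.inr ⟨ha.1, hSC a ha⟩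

/-- Every induced subgraph of a chordal graph has a tree model. -/
theorem IsChordal.exists_represents [Finite V] (hG : IsChordal G) (W : Set V) :
    ∃ (N : Type) (_ : Fintype N) (T : SimpleGraph N) (b : N → Set V), Represents G W T b := by
  induction W using WellFoundedLT.induction with
  | ind W ih =>
    by_cases hW : ∀ u ∈ W, ∀ v ∈ W, u ≠ v → G.Adj u v
    · exact ⟨Unit, inferInstance, ⊥, _, represents_of_clique hW⟩
    push Not at hW
    obtain ⟨v, hv, w, hw, hvw, hadj⟩ := hW
    obtain ⟨W₁, W₂, h1, h2, h3, h4, h5⟩ := exists_clique_separation hG hv hw hvw hadj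
    obtain ⟨N₁, _, T₁, b₁, hr₁⟩ := ih W₁ h1
    obtain ⟨N₂, _, T₂, b₂, hr₂⟩ := ih W₂ h2
    obtain ⟨T, hT⟩ := hr₁.glue hr₂ h4 h5
    exact ⟨N₁ ⊕ N₂, inferInstance, T, _, h3 ▸ hT⟩

end ChordalLeafage

/-! ### Paths as trees with at most two leaves. -/

namespace ChordalLeafage

open SimpleGraph

/-- Without branching, a path between two leaves uses every edge at each of its nodes; hence no edge
leads out of it. -/
theorem neighborSet_toSubgraph_eq {W : Type*} [Finite W] {T : SimpleGraph W}
    (hle : ∀ x, (T.neighborSet x).ncard ≤ 2) {a c : W} (hac : a ≠ c) (ha : a ∈ leaves T)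
    (hc : c ∈ leaves T) {q : T.Walk a c} (hq : q.IsPath) {w : W} (hw : w ∈ q.support) :
    q.toSubgraph.neighborSet w = T.neighborSet w := by
  have hnil : ¬ q.Nil := fun h => hac h.eq
  refine Set.eq_of_subset_of_ncard_le (fun y hy => q.toSubgraph.adj_sub hy) ?_
  by_cases hwa : w = a
  · subst hwa
    rw [hq.neighborSet_toSubgraph_startpoint hnil, Set.ncard_singleton]
    exact (show (T.neighborSet w).ncard = 1 from ha).le
  by_cases hwc : w = c
  · subst hwc
    rw [hq.neighborSet_toSubgraph_endpoint hnil, Set.ncard_singleton]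
    exact (show (T.neighborSet w).ncard = 1 from hc).le
  obtain ⟨i, rfl, hi⟩ := Walk.mem_support_iff_exists_getVert.1 hw
  have h0 : i ≠ 0 := by
    rintro rfl
    exact hwa q.getVert_zero
  have h1 : i ≠ q.length := by
    rintro rfl
    exact hwc q.getVert_length
  rw [hq.ncard_neighborSet_toSubgraph_internal_eq_two h0 (by omega)]
  exact hle _

/-- A finite tree with at most two leaves is a path. -/
theorem exists_isPath_toSubgraph_eq_top {W : Type*} [Finite W] {T : SimpleGraph W}
    (hT : T.IsTree) (h : (leaves T).ncard ≤ 2) :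
    ∃ (a c : W) (q : T.Walk a c), q.IsPath ∧ q.toSubgraph = ⊤ := by
  have := Fintype.ofFinite W
  by_cases hW : Fintype.card W = 1
  · have hs : Subsingleton W := Fintype.card_le_one_iff_subsingleton.1 hW.le
    obtain ⟨a⟩ := hT.connected.nonempty
    refine ⟨a, a, Walk.nil, Walk.IsPath.nil, Subgraph.ext ?_ ?_⟩
    · ext x
      simp [Subsingleton.elim x a]
    · ext x y
      simp only [Subgraph.top_adj]
      exact ⟨fun h => Subgraph.adj_sub _ h, fun h => (h.ne (Subsingleton.elim _ _)).elim⟩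
  have hl := ncard_leaves hT hW
  have hle : ∀ x, (T.neighborSet x).ncard ≤ 2 := by
    intro x
    have := Finset.single_le_sum (f := fun x => (T.neighborSet x).ncard - 2)
      (fun _ _ => Nat.zero_le _) (Finset.mem_univ x)
    omega
  obtain ⟨a, c, hac, hleaves⟩ := Set.ncard_eq_two.1 (show (leaves T).ncard = 2 by omega)
  have ha : a ∈ leaves T := by simp [hleaves]
  have hc : c ∈ leaves T := by simp [hleaves]
  obtain ⟨q, hq⟩ := (hT.connected.preconnected a c).exists_isPath
  have hnb := fun {w} (hw : w ∈ q.support) => neighborSet_toSubgraph_eq hle hac ha hc hq hw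
  have hall : ∀ x, x ∈ q.support := by
    intro x
    by_contra hx
    obtain ⟨p⟩ := hT.connected.preconnected a x
    obtain ⟨d, -, hd1, hd2⟩ := p.exists_boundary_dart {w | w ∈ q.support} q.start_mem_support hx
    have h1 : d.snd ∈ q.toSubgraph.neighborSet d.fst := by
      rw [hnb hd1]
      exact d.adj
    exact hd2 (q.mem_verts_toSubgraph.1 (q.toSubgraph.edge_vert h1.symm))
  refine ⟨a, c, q, hq, Subgraph.ext ?_ ?_⟩
  · ext x
    simp [hall x]
  · ext x y
    have := Set.ext_iff.1 (hnb (hall x)) y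
    simpa using this

theorem exists_isPath_eq_toSubgraph {N : Type*} [Finite N] {T : SimpleGraph N} (H : T.Subgraph)
    (hH : H.coe.IsTree) (h : (leaves H.coe).ncard ≤ 2) :
    ∃ (a c : N) (p : T.Walk a c), p.IsPath ∧ H = p.toSubgraph := by
  obtain ⟨a, c, q, hq, htop⟩ := exists_isPath_toSubgraph_eq_top hH h
  refine ⟨_, _, q.map H.hom, hq.map H.hom_injective, ?_⟩
  rw [Walk.toSubgraph_map, htop, Subgraph.map_hom_top]

theorem ncard_leaves_toSubgraph_le {N : Type*} {T : SimpleGraph N} {a c : N} {p : T.Walk a c}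
    (hp : p.IsPath) : (leaves p.toSubgraph.coe).ncard ≤ 2 := by
  have hsub : Subtype.val '' leaves p.toSubgraph.coe ⊆ {a, c} := by
    rintro _ ⟨x, hx, rfl⟩
    have hx1 : (p.toSubgraph.coe.neighborSet x).ncard = 1 := hx
    have hnb : Subtype.val '' p.toSubgraph.coe.neighborSet x = p.toSubgraph.neighborSet x.1 := by
      ext y
      constructor
      · rintro ⟨z, hz, rfl⟩
        exact hz
      · intro hy
        exact ⟨⟨y, p.toSubgraph.edge_vert hy.symm⟩, hy, rfl⟩
    rw [← Set.ncard_image_of_injective _ Subtype.val_injective, hnb] at hx1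
    obtain ⟨i, hi, hil⟩ :=
      Walk.mem_support_iff_exists_getVert.1 (p.mem_verts_toSubgraph.1 x.2)
    rw [← hi] at hx1 ⊢
    by_cases h0 : i = 0
    · simp [h0]
    by_cases h1 : i = p.length
    · simp [h1]
    rw [hp.ncard_neighborSet_toSubgraph_internal_eq_two h0 (by omega)] at hx1
    omega
  rw [← Set.ncard_image_of_injective _ Subtype.val_injective]
  exact (Set.ncard_le_ncard hsub (Set.toFinite _)).trans (Set.ncard_insert_le _ _ |>.trans (by simp))

/-! ### From bag trees back to tree models. -/

variable {V : Type*} {G : SimpleGraph V}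

/-- The vertices of `G` whose subtrees contain the node `x`. -/
def TreeModel.bag (M : TreeModel G) (x : M.Node) : Set V :=
  {u | x ∈ (M.subtree u).verts}

theorem TreeModel.isBagTree (M : TreeModel G) : IsBagTree M.host M.bag :=
  ⟨M.host_isTree, fun u => connOn_verts M.host_isTree.isAcyclic _ (M.subtree_isTree u)⟩

theorem TreeModel.exists_mem_bag_iff (M : TreeModel G) (u v : V) :
    (∃ p, u ∈ M.bag p ∧ v ∈ M.bag p) ↔ u = v ∨ G.Adj u v := by
  by_cases huv : u = v
  · subst huv
    obtain ⟨p, hp⟩ := (M.subtree_isTree u).connected.nonempty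
    exact iff_of_true ⟨p, hp, hp⟩ (Or.inl rfl)
  · rw [M.adj_iff u v huv]
    simp only [huv, false_or]
    rfl

theorem TreeModel.subtreeLeaves_eq (M : TreeModel G) [Fintype M.Node] (u : V) :
    M.subtreeLeaves u =
      if {p | u ∈ M.bag p}.ncard = 1 then 0 else 2 + excess M.host {p | u ∈ M.bag p} :=
  ncard_leaves_coe M.host_isTree.isAcyclic _ (M.subtree_isTree u)

theorem TreeModel.hostLeaves_eq (M : TreeModel G) [Fintype M.Node] :
    M.hostLeaves = if Fintype.card M.Node = 1 then 0 else 2 + excess M.host Set.univ :=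
  ncard_leaves_eq M.host_isTree

/-- The tree model given by a tree with bags. -/
def IsBagTree.toTreeModel {N : Type} [Finite N] {T : SimpleGraph N} {b : N → Set V}
    (h : IsBagTree T b) (hb : ∀ u v, (∃ p, u ∈ b p ∧ v ∈ b p) ↔ u = v ∨ G.Adj u v) :
    TreeModel G where
  Node := N
  finite_node := inferInstance
  host := T
  host_isTree := h.isTree
  subtree u := (⊤ : T.Subgraph).induce {p | u ∈ b p}
  subtree_isTree u := by
    obtain ⟨p, hp, -⟩ := (hb u u).2 (Or.inl rfl)
    have h1 := (h.connOn u).isTree_induce h.isTree.isAcyclic ⟨p, hp⟩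
    have h2 : ((⊤ : T.Subgraph).induce {p | u ∈ b p}).coe = T.induce {p | u ∈ b p} := by
      ext x y
      exact ⟨fun hxy => hxy.2.2, fun hxy => ⟨x.2, y.2, hxy⟩⟩
    rw [h2]
    exact h1
  adj_iff u v huv := by
    have := hb u v
    simp only [huv, false_or] at this
    rw [← this]
    rfl

/-- Two tree models of `G` can be combined into one that has as few leaves on every subtree as
the first and as few leaves of the host tree as the second. -/
theorem TreeModel.exists_combining [Finite V] (M₁ M₂ : TreeModel G) :
    ∃ M : TreeModel G, (∀ u, M.subtreeLeaves u ≤ M₁.subtreeLeaves u) ∧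
      M.hostLeaves ≤ M₂.hostLeaves := by
  have := M₁.finite_node
  have := M₂.finite_node
  have := Fintype.ofFinite M₁.Node
  have := Fintype.ofFinite M₂.Node
  obtain ⟨N, _, T, b, h, hb, hcard, hex, hu⟩ := exists_bagTree_combining M₁.isBagTree
    M₂.isBagTree fun u v => (M₁.exists_mem_bag_iff u v).trans (M₂.exists_mem_bag_iff u v).symm
  have hb' := fun u v => (hb u v).trans (M₁.exists_mem_bag_iff u v)
  let M := h.toTreeModel hb'
  refine ⟨M, fun u => ?_, ?_⟩
  · have h1 : 0 < {p | u ∈ b p}.ncard := by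
      obtain ⟨p, hp, -⟩ := (hb' u u).2 (Or.inl rfl)
      exact (Set.ncard_pos (Set.toFinite _)).2 ⟨p, hp⟩
    have h2 : M.subtreeLeaves u =
        if {p | u ∈ b p}.ncard = 1 then 0 else 2 + excess T {p | u ∈ b p} :=
      ncard_leaves_coe (N := N) h.isTree.isAcyclic _ (M.subtree_isTree u)
    rw [h2, M₁.subtreeLeaves_eq]
    have := hu u
    split_ifs <;> omega
  · have h1 : 0 < Fintype.card N := Fintype.card_pos_iff.2 h.isTree.connected.nonempty
    have h2 : M.hostLeaves = if Fintype.card N = 1 then 0 else 2 + excess T Set.univ :=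
      ncard_leaves_eq (N := N) h.isTree
    rw [h2, M₂.hostLeaves_eq]
    split_ifs <;> omega

theorem IsChordal.nonempty_treeModel [Finite V] (hG : IsChordal G) : Nonempty (TreeModel G) := by
  obtain ⟨N, _, T, b, h⟩ := hG.exists_represents Set.univ
  refine ⟨h.toIsBagTree.toTreeModel fun u v => ?_⟩
  by_cases huv : u = v
  · subst huv
    simpa using (h.cover u).2 trivial
  · simp only [huv, false_or]
    exact (h.adj_iff u trivial v trivial huv).symm

theorem TreeModel.exists_hostLeaves_eq_leafage (M₀ : TreeModel G) :
    ∃ M : TreeModel G, M.hostLeaves = leafage G :=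
  -- `M₀` excludes the default value `0` of the infimum of the empty set.
  Nat.sInf_mem (s := {k | ∃ M : TreeModel G, M.hostLeaves = k}) ⟨_, M₀, rfl⟩

theorem TreeModel.exists_subtreeLeaves_le_vertexLeafage [Finite V] (M₀ : TreeModel G) :
    ∃ M : TreeModel G, ∀ u, M.subtreeLeaves u ≤ vertexLeafage G := by
  refine Nat.sInf_mem (s := {k | ∃ M : TreeModel G, ∀ u, M.subtreeLeaves u ≤ k}) ?_
  -- Finiteness of `V` gives one bound for all subtrees of `M₀`.
  obtain ⟨k, hk⟩ := (Set.finite_range M₀.subtreeLeaves).bddAbove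
  exact ⟨k, M₀, fun u => hk ⟨u, rfl⟩⟩

theorem TreeModel.exists_hostLeaves_eq_leafage_and_le [Finite V] (M₀ : TreeModel G) :
    ∃ M : TreeModel G, (∀ u, M.subtreeLeaves u ≤ M₀.subtreeLeaves u) ∧
      M.hostLeaves = leafage G := by
  obtain ⟨M₁, hM₁⟩ := M₀.exists_hostLeaves_eq_leafage
  obtain ⟨M, h1, h2⟩ := M₀.exists_combining M₁
  exact ⟨M, h1, le_antisymm (hM₁ ▸ h2) (Nat.sInf_le ⟨M, rfl⟩)⟩

theorem TreeModel.IsPathModel.subtreeLeaves_le {M : TreeModel G} (hM : M.IsPathModel) (u : V) :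
    M.subtreeLeaves u ≤ 2 := by
  obtain ⟨a, c, p, hp, hu⟩ := hM u
  rw [TreeModel.subtreeLeaves, hu]
  exact ncard_leaves_toSubgraph_le hp

theorem TreeModel.isPathModel_of_subtreeLeaves_le {M : TreeModel G}
    (h : ∀ u, M.subtreeLeaves u ≤ 2) : M.IsPathModel := fun u =>
  have := M.finite_node
  exists_isPath_eq_toSubgraph _ (M.subtree_isTree u) (h u)

end ChordalLeafage

theorem corollary4 {V : Type*} [Finite V] (G : SimpleGraph V) :
    (ChordalLeafage.IsChordal G →
      ∃ M : ChordalLeafage.TreeModel G,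
        (∀ u, M.subtreeLeaves u ≤ ChordalLeafage.vertexLeafage G) ∧
        M.hostLeaves = ChordalLeafage.leafage G) ∧
    (ChordalLeafage.IsPathGraph G →
      ∃ M : ChordalLeafage.TreeModel G,
        M.IsPathModel ∧ M.hostLeaves = ChordalLeafage.leafage G) := by
  refine ⟨fun hG => ?_, fun ⟨M₀, hM₀⟩ => ?_⟩
  · obtain ⟨M₀⟩ := hG.nonempty_treeModel
    obtain ⟨M₁, hM₁⟩ := M₀.exists_subtreeLeaves_le_vertexLeafage
    obtain ⟨M, h1, h2⟩ := M₁.exists_hostLeaves_eq_leafage_and_le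
    exact ⟨M, fun u => (h1 u).trans (hM₁ u), h2⟩
  · obtain ⟨M, h1, h2⟩ := M₀.exists_hostLeaves_eq_leafage_and_le
    exact ⟨M, ChordalLeafage.TreeModel.isPathModel_of_subtreeLeaves_le
      fun u => (h1 u).trans (hM₀.subtreeLeaves_le u), h2⟩
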